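/- Let $F$ be a field (of arbitrary characteristic), let $n\ge 3$, and let $\varphi$ be a nondegenerate quadratic form on an $F$-vector space $V$ of dimension $2n+1$; that is, the radical of the polar bilinear form of $\varphi$ has dimension at most $1$, and $\varphi$ has no nontrivial zero on it. Let $X_2$ be the smooth projective $F$-variety of $2$-dimensional totally isotropic subspaces of $V$, and let $\deg\colon \operatorname{CH}(X_2)\to\mathbb{Z}$ be the degree homomorphism, which sends the class of a closed point $x$ to $[F(x):F]$ and vanishes on classes of cycles of positive dimension. The Witt index $\mathfrak{i}_0(\psi)$ of a quadratic form $\psi$ is the number of hyperbolic planes in its Witt decomposition. Let $F_1=F(\varphi_{\mathrm{an}})$ be the function field of the projective quadric defined by the anisotropic part $\varphi_{\mathrm{an}}$ of $\varphi$, and let $\mathfrak{j}_1(\varphi)=\mathfrak{i}_0(\varphi_{F_1})$ be the first absolute higher Witt index of $\varphi$ (it is defined when $\dim\varphi_{\mathrm{an}}\ge 2$). If $\deg\operatorname{CH}(X_2)=4\mathbb{Z}$, then $\varphi$ is anisotropic and $\mathfrak{j}_1(\varphi)=1$. -/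

import Mathlib

open AlgebraicGeometry CategoryTheory TensorProduct

universe u v

/-! ### Quadratic forms over fields of arbitrary characteristic -/

/-- Nondegeneracy of a quadratic form in arbitrary characteristic: the radical of the polar form
has dimension at most one, and the form has no nontrivial zero on that radical. -/
def IsNondegenerateForm {F : Type u} [Field F] {V : Type v} [AddCommGroup V] [Module F V]
    (φ : QuadraticForm F V) : Prop :=
  Module.finrank F (LinearMap.ker φ.polarBilin) ≤ 1 ∧
    ∀ v ∈ LinearMap.ker φ.polarBilin, φ v = 0 → v = 0

/-- The extension `φ_E` of a quadratic form to an extension field `E`, in arbitrary characteristic: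
write `φ v = B v v` with a (not necessarily symmetric) bilinear form `B` and extend `B`. -/
noncomputable def formBaseChange {F : Type u} [Field F] {V : Type v} [AddCommGroup V] [Module F V]
    [FiniteDimensional F V] (φ : QuadraticForm F V) (E : Type u) [Field E] [Algebra F E] :
    QuadraticForm E (E ⊗[F] V) :=
  (LinearMap.BilinForm.baseChange E (φ.toBilin (Module.finBasis F V))).toQuadraticMap

/-- `W` and `m` give a Witt decomposition: `φ` is isometric to the orthogonal sum of `m` hyperbolic
planes (that is, of the hyperbolic space on `F ^ m`) and the anisotropic form `φ|_W`. -/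
def IsWittDecomposition {F : Type u} [Field F] {V : Type v} [AddCommGroup V] [Module F V]
    (φ : QuadraticForm F V) (m : ℕ) (W : Submodule F V) : Prop :=
  (φ.restrict W).Anisotropic ∧
    φ.Equivalent ((QuadraticForm.dualProd F (Fin m → F)).prod (φ.restrict W))

/-- The Witt index `𝔦₀(φ)`: the number of hyperbolic planes in a Witt decomposition of `φ`
(which, for a nondegenerate form, exists and determines this number). -/
noncomputable def wittIndex {F : Type u} [Field F] {V : Type v} [AddCommGroup V] [Module F V]
    (φ : QuadraticForm F V) : ℕ :=
  sInf {m | ∃ W : Submodule F V, IsWittDecomposition φ m W}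

/-- A subspace `W` such that `φ|_W` is the anisotropic part of `φ`, which is unique up to
isometry. -/
noncomputable def anisotropicSubspace {F : Type u} [Field F] {V : Type v} [AddCommGroup V]
    [Module F V] (φ : QuadraticForm F V) : Submodule F V :=
  Classical.epsilon fun W => ∃ m, IsWittDecomposition φ m W

/-! ### The function field of a projective quadric -/

/-- The homogeneous quadratic polynomial of `φ` in the coordinates of a basis. -/
noncomputable def formPolynomial {F : Type u} [Field F] {V : Type v} [AddCommGroup V] [Module F V]
    [FiniteDimensional F V] (φ : QuadraticForm F V) :
    MvPolynomial (Fin (Module.finrank F V)) F :=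
  ∑ i, ∑ j, MvPolynomial.C (φ.toBilin (Module.finBasis F V) (Module.finBasis F V i)
    (Module.finBasis F V j)) * (MvPolynomial.X i * MvPolynomial.X j)

theorem eval_formPolynomial {F : Type u} [Field F] {V : Type v} [AddCommGroup V] [Module F V]
    [FiniteDimensional F V] (φ : QuadraticForm F V) (x : Fin (Module.finrank F V) → F) :
    MvPolynomial.eval x (formPolynomial φ) = φ (∑ i, x i • Module.finBasis F V i) := by
  conv_rhs => rw [← QuadraticMap.toQuadraticMap_toBilin φ (Module.finBasis F V)]
  rw [LinearMap.BilinMap.toQuadraticMap_apply]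
  simp only [formPolynomial, map_sum, map_mul, MvPolynomial.eval_C, MvPolynomial.eval_X,
    LinearMap.sum_apply, map_smul, LinearMap.smul_apply, smul_eq_mul, Finset.mul_sum]
  rw [Finset.sum_comm]
  refine Finset.sum_congr rfl fun i _ => Finset.sum_congr rfl fun j _ => ?_
  ring

theorem isHomogeneous_formPolynomial {F : Type u} [Field F] {V : Type v} [AddCommGroup V]
    [Module F V] [FiniteDimensional F V] (φ : QuadraticForm F V) :
    (formPolynomial φ).IsHomogeneous 2 := by
  refine MvPolynomial.IsHomogeneous.sum _ _ _ fun i _ =>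
    MvPolynomial.IsHomogeneous.sum _ _ _ fun j _ => ?_
  simpa using (MvPolynomial.isHomogeneous_C _ _).mul
    ((MvPolynomial.isHomogeneous_X F i).mul (MvPolynomial.isHomogeneous_X F j))

theorem prime_formPolynomial {F : Type u} [Field F] {V : Type v} [AddCommGroup V] [Module F V]
    [FiniteDimensional F V] (φ : QuadraticForm F V) (h : φ.Anisotropic)
    (h2 : 2 ≤ Module.finrank F V) : Prime (formPolynomial φ) := by
  have hne : ∀ x : Fin (Module.finrank F V) → F, x ≠ 0 →
      MvPolynomial.eval x (formPolynomial φ) ≠ 0 := by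
    intro x hx h0
    rw [eval_formPolynomial] at h0
    have hs := h _ h0
    have hl := Fintype.linearIndependent_iff.1 (Module.finBasis F V).linearIndependent x hs
    exact hx (funext hl)
  have hq0 : formPolynomial φ ≠ 0 := by
    intro h0
    have hx : (Pi.single ⟨0, by omega⟩ 1 : Fin (Module.finrank F V) → F) ≠ 0 := by
      simp
    exact hne _ hx (by rw [h0, map_zero])
  have hdeg : (formPolynomial φ).totalDegree = 2 :=
    (isHomogeneous_formPolynomial φ).totalDegree hq0
  have hunit : ∀ a : MvPolynomial (Fin (Module.finrank F V)) F, a ≠ 0 → a.totalDegree = 0 →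
      IsUnit a := by
    intro a ha h0
    rw [MvPolynomial.totalDegree_eq_zero_iff_eq_C] at h0
    rw [h0] at ha ⊢
    have hc : MvPolynomial.coeff 0 a ≠ 0 := by
      intro hc
      exact ha (by rw [hc, map_zero])
    exact (IsUnit.mk0 _ hc).map MvPolynomial.C
  refine Irreducible.prime ⟨fun hu => ?_, ?_⟩
  · have := (MvPolynomial.isUnit_iff_totalDegree_of_isReduced.1 hu).2
    omega
  · intro a b hab
    have ha0 : a ≠ 0 := by rintro rfl; exact hq0 (by rw [hab, zero_mul])
    have hb0 : b ≠ 0 := by rintro rfl; exact hq0 (by rw [hab, mul_zero])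
    have hd := MvPolynomial.totalDegree_mul_of_isDomain ha0 hb0
    rw [← hab, hdeg] at hd
    rcases Nat.eq_zero_or_pos a.totalDegree with h1 | h1
    · exact Or.inl (hunit a ha0 h1)
    rcases Nat.eq_zero_or_pos b.totalDegree with h3 | h3
    · exact Or.inr (hunit b hb0 h3)
    exfalso
    have key : ∀ c : MvPolynomial (Fin (Module.finrank F V)) F, c.totalDegree = 1 →
        c = MvPolynomial.homogeneousComponent 0 c + MvPolynomial.homogeneousComponent 1 c := by
      intro c hc
      conv_lhs => rw [← MvPolynomial.sum_homogeneousComponent c, hc]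
      simp [Finset.sum_range_succ]
    have ea := key a (by omega)
    have eb := key b (by omega)
    have ha := MvPolynomial.homogeneousComponent_isHomogeneous 0 a
    have ha' := MvPolynomial.homogeneousComponent_isHomogeneous 1 a
    have hb := MvPolynomial.homogeneousComponent_isHomogeneous 0 b
    have hb' := MvPolynomial.homogeneousComponent_isHomogeneous 1 b
    set a₀ := MvPolynomial.homogeneousComponent 0 a
    set a₁ := MvPolynomial.homogeneousComponent 1 a
    set b₀ := MvPolynomial.homogeneousComponent 0 b
    set b₁ := MvPolynomial.homogeneousComponent 1 b
    have hab' : formPolynomial φ = a₁ * b₁ := by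
      have e : formPolynomial φ = a₀ * b₀ + (a₀ * b₁ + a₁ * b₀) + a₁ * b₁ := by
        rw [hab, ea, eb]; ring
      have e2 := congrArg (MvPolynomial.homogeneousComponent 2) e
      rw [map_add, map_add,
        MvPolynomial.homogeneousComponent_of_mem (isHomogeneous_formPolynomial φ),
        MvPolynomial.homogeneousComponent_of_mem (ha.mul hb),
        MvPolynomial.homogeneousComponent_of_mem
          (((ha.mul hb').add (ha'.mul hb) : MvPolynomial.IsHomogeneous _ 1)),
        MvPolynomial.homogeneousComponent_of_mem (ha'.mul hb')] at e2
      simpa using e2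
    obtain ⟨L, hL⟩ : ∃ L : (Fin (Module.finrank F V) → F) →ₗ[F] F,
        ∀ x, MvPolynomial.eval x a₁ = L x := by
      have hm : a₁ ∈ Submodule.span F (Set.range MvPolynomial.X) := by
        rw [← MvPolynomial.homogeneousSubmodule_one_eq_span_X]
        exact ha'
      clear_value a₁
      clear ea ha' hab'
      induction hm using Submodule.span_induction with
      | mem y hy =>
        obtain ⟨i, rfl⟩ := hy
        exact ⟨LinearMap.proj i, fun x => by simp⟩
      | zero => exact ⟨0, fun x => by simp⟩
      | add y z _ _ hy hz =>
        obtain ⟨L, hL⟩ := hy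
        obtain ⟨M, hM⟩ := hz
        exact ⟨L + M, fun x => by simp [hL, hM]⟩
      | smul c y _ hy =>
        obtain ⟨L, hL⟩ := hy
        exact ⟨c • L, fun x => by simp [hL]⟩
    have hker : LinearMap.ker L ≠ ⊥ := by
      refine LinearMap.ker_ne_bot_of_finrank_lt ?_
      rw [Module.finrank_self, Module.finrank_fin_fun]
      omega
    obtain ⟨x, hx, hx0⟩ := Submodule.exists_mem_ne_zero_of_ne_bot hker
    refine hne x hx0 ?_
    rw [hab', map_mul, hL, LinearMap.mem_ker.1 hx, zero_mul]

/-- A field extension of `F`. -/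
structure FieldExtension (F : Type u) [Field F] where
  carrier : Type u
  [field : Field carrier]
  [algebra : Algebra F carrier]

attribute [instance] FieldExtension.field FieldExtension.algebra

/-- The function field `F(φ)` of the projective quadric `φ = 0` of an anisotropic form of dimension
at least two: the subfield of the fraction field of the homogeneous coordinate ring
`F[x₁, …, xₙ] / (φ)` that is generated over `F` by the quotients `xᵢ / xⱼ`. -/
noncomputable def quadricFunctionField {F : Type u} [Field F] {V : Type v} [AddCommGroup V]
    [Module F V] [FiniteDimensional F V] (φ : QuadraticForm F V) (h : φ.Anisotropic)
    (h2 : 2 ≤ Module.finrank F V) : FieldExtension F :=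
  haveI : (Ideal.span {formPolynomial φ}).IsPrime :=
    (Ideal.span_singleton_prime (prime_formPolynomial φ h h2).ne_zero).2
      (prime_formPolynomial φ h h2)
  let A := MvPolynomial (Fin (Module.finrank F V)) F ⧸ Ideal.span {formPolynomial φ}
  let x : Fin (Module.finrank F V) → FractionRing A := fun i =>
    algebraMap A (FractionRing A) (Ideal.Quotient.mk _ (MvPolynomial.X i))
  { carrier := IntermediateField.adjoin F {z : FractionRing A | ∃ i j, z = x i / x j} }

/-! ### Higher Witt indices -/

/-- One step `E ↦ E((φ_E)_an)` of the generic splitting tower of `φ`; the tower stops when the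
anisotropic part of `φ_E` has dimension at most one. -/
noncomputable def towerStep {F : Type u} [Field F] {V : Type v} [AddCommGroup V] [Module F V]
    [FiniteDimensional F V] (φ : QuadraticForm F V) (E : FieldExtension F) : FieldExtension F :=
  let φE := formBaseChange φ E.carrier
  let W := anisotropicSubspace φE
  open Classical in
  if h : (φE.restrict W).Anisotropic ∧ 2 ≤ Module.finrank E.carrier W then
    let L := quadricFunctionField (φE.restrict W) h.1 h.2
    { carrier := L.carrier
      algebra := ((algebraMap E.carrier L.carrier).comp (algebraMap F E.carrier)).toAlgebra }
  else E

/-- The fields `F₀ = F`, `Fₖ = Fₖ₋₁((φ_{Fₖ₋₁})_an)` of the generic splitting tower. -/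
noncomputable def splittingTower {F : Type u} [Field F] {V : Type v} [AddCommGroup V] [Module F V]
    [FiniteDimensional F V] (φ : QuadraticForm F V) : ℕ → FieldExtension F
  | 0 => { carrier := F }
  | k + 1 => towerStep φ (splittingTower φ k)

/-- The `k`-th absolute higher Witt index `𝔧ₖ(φ) = 𝔦₀(φ_{Fₖ})`. -/
noncomputable def absoluteWittIndex {F : Type u} [Field F] {V : Type v} [AddCommGroup V]
    [Module F V] [FiniteDimensional F V] (φ : QuadraticForm F V) (k : ℕ) : ℕ :=
  wittIndex (formBaseChange φ (splittingTower φ k).carrier)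

/-! ### Chow groups and degrees -/

/-- The cycles rationally equivalent to zero: the subgroup generated by the divisors `div f`
of nonzero rational functions `f` on integral closed subschemes `i : Y ⟶ X`. -/
def rationallyTrivialCycles (X : Scheme.{u}) : AddSubgroup (AlgebraicCycle X ℤ) :=
  AddSubgroup.closure {z | ∃ (Y : Scheme.{u}) (_ : IsIntegral Y) (_ : IsLocallyNoetherian Y)
    (i : Y ⟶ X) (_ : IsClosedImmersion i) (f : Y.functionField), f ≠ 0 ∧
      (∀ y : Y, z (i y) = Y.ord f y) ∧ ∀ x : X, x ∉ Set.range i → z x = 0}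

/-- The (total) Chow group of a scheme: cycles modulo rational equivalence. -/
abbrev ChowGroup (X : Scheme.{u}) : Type u :=
  AlgebraicCycle X ℤ ⧸ rationallyTrivialCycles X

/-- The degree of a cycle on a scheme `p : X ⟶ Spec F`: the sum of the multiplicities of the closed
points, weighted by the degrees of their residue fields over `F`. (The residue field of a point that
is not closed has infinite degree over `F`, and `residueDegree` is then zero.) -/
noncomputable def cycleDegree {X : Scheme.{u}} {F : Type u} [Field F] (p : X ⟶ Spec (.of F))
    (z : AlgebraicCycle X ℤ) : ℤ :=
  ∑ᶠ x : X, z x * (p.residueDegree x : ℤ)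

/-- The image `deg CH(X)` of the degree map `CH(X) → ℤ`, which sends the class of a cycle
to the degree of the cycle. -/
def degreeImage {X : Scheme.{u}} {F : Type u} [Field F] (p : X ⟶ Spec (.of F)) : Set ℤ :=
  {d | ∃ α : ChowGroup X, ∃ z : AlgebraicCycle X ℤ,
    (QuotientAddGroup.mk z : ChowGroup X) = α ∧ cycleDegree p z = d}

/-! ### The variety of totally isotropic planes -/

/-- The homogeneous equations, in the coordinates `p (i, j)` of the space of square matrices, of
the totally isotropic planes in the Plücker embedding. A plane spanned by `v, w` corresponds to the
line of the matrix `p (i, j) = vᵢ wⱼ - vⱼ wᵢ`. The equations say that the matrix is alternating, that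
it satisfies the Plücker relations (so that, if it is not zero, its rows span a plane), and that the
rows of the matrix span a totally isotropic subspace. -/
def isotropicPlaneEquations {F : Type u} [Field F] {V : Type v} [AddCommGroup V] [Module F V]
    [FiniteDimensional F V] (φ : QuadraticForm F V) :
    Set (MvPolynomial (Fin (Module.finrank F V) × Fin (Module.finrank F V)) F) :=
  let p := fun i j : Fin (Module.finrank F V) =>
    (MvPolynomial.X (i, j) :
      MvPolynomial (Fin (Module.finrank F V) × Fin (Module.finrank F V)) F)
  let b := Module.finBasis F V
  {g | (∃ i, g = p i i) ∨ (∃ i j, g = p i j + p j i) ∨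
    (∃ i j k l, g = p i j * p k l - p i k * p j l + p i l * p j k) ∨
    (∃ k, g = MvPolynomial.aeval (p k) (formPolynomial φ)) ∨
    (∃ k l, g = ∑ i, ∑ j,
      MvPolynomial.C (QuadraticMap.polar φ (b i) (b j)) * (p k i * p l j))}

attribute [local instance] MvPolynomial.gradedAlgebra

/-- The projective space in which the totally isotropic planes are embedded. -/
noncomputable abbrev pluckerSpace (F : Type u) [Field F] (N : ℕ) : Scheme.{u} :=
  Proj (MvPolynomial.homogeneousSubmodule (Fin N × Fin N) F)

/-- The structure morphism of the projective space. -/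
noncomputable def pluckerSpaceToSpec (F : Type u) [Field F] (N : ℕ) :
    pluckerSpace F N ⟶ Spec (.of F) :=
  Proj.toSpecZero (MvPolynomial.homogeneousSubmodule (Fin N × Fin N) F) ≫
    Spec.map (CommRingCat.ofHom
      (algebraMap F (MvPolynomial.homogeneousSubmodule (Fin N × Fin N) F 0)))

/-- The closed set of totally isotropic planes in projective space. -/
noncomputable def isotropicPlaneLocus {F : Type u} [Field F] {V : Type v} [AddCommGroup V]
    [Module F V] [FiniteDimensional F V] (φ : QuadraticForm F V) :
    TopologicalSpace.Closeds (pluckerSpace F (Module.finrank F V)) :=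
  ⟨ProjectiveSpectrum.zeroLocus _ (isotropicPlaneEquations φ),
    ProjectiveSpectrum.isClosed_zeroLocus _ _⟩

/-- The variety `X₂` of two-dimensional totally isotropic subspaces of `V`: the closed subset of
totally isotropic planes with its reduced scheme structure (`X₂` is smooth, hence reduced). -/
noncomputable def isotropicPlaneVariety {F : Type u} [Field F] {V : Type v} [AddCommGroup V]
    [Module F V] [FiniteDimensional F V] (φ : QuadraticForm F V) : Scheme.{u} :=
  (Scheme.IdealSheafData.vanishingIdeal (isotropicPlaneLocus φ)).subscheme

/-- The structure morphism `X₂ ⟶ Spec F`. -/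
noncomputable def isotropicPlaneVarietyToSpec {F : Type u} [Field F] {V : Type v} [AddCommGroup V]
    [Module F V] [FiniteDimensional F V] (φ : QuadraticForm F V) :
    isotropicPlaneVariety φ ⟶ Spec (.of F) :=
  (Scheme.IdealSheafData.vanishingIdeal (isotropicPlaneLocus φ)).subschemeι ≫
    pluckerSpaceToSpec F (Module.finrank F V)

/-! ### Points of schemes with values in finite extensions -/

/-! A totally isotropic plane over a finite extension `K` of `F` is a `K`-point of `X₂`, and the
residue degree of its image divides `[K : F]`. That residue degree is the degree of a cycle, so the
hypothesis forces `4 ∣ [K : F]`. Hence there is no totally isotropic plane over an extension of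
degree one or two (`not_hasIsotropicPair_of_degreeImage`), and both conclusions follow from this.

Anisotropy: if `φ x = 0` with `x ≠ 0`, choose `y`, `z` orthogonal to `x` with `x, y, z` independent.
Unless `φ y = 0` already, the quadratic equation `φ (α y + z) = 0` is solvable over an extension of
degree at most two, and `x`, `α y + z` span an isotropic plane there
(`exists_hasIsotropicPair_of_isotropic`).

First Witt index: over the function field `L` of the quadric, `φ` has an isotropic vector, which
nondegeneracy keeps out of the radical, so a hyperbolic plane splits off. If the complement were
isotropic, there would be an isotropic plane over `L`. Such a plane lives over the fraction field of
the affine cone; clear denominators and specialize it along successive hyperplane sections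
(`HasIsotropicPair.specialize`). Each section is integral because an anisotropic form in at least
two variables is prime. The last section is the spectrum of a quadratic extension of `F`, where
isotropic planes are excluded. -/

theorem finrank_toAlgebra_comp {K L M : Type*} [Field K] [Field L] [Field M]
    (f : K →+* L) (g : L →+* M) (h : K →+* M) (hc : h = g.comp f) :
    @Module.finrank K M _ _ h.toAlgebra.toModule =
      @Module.finrank K L _ _ f.toAlgebra.toModule *
        @Module.finrank L M _ _ g.toAlgebra.toModule := by
  let := f.toAlgebra
  let := g.toAlgebra
  let := h.toAlgebra
  have : IsScalarTower K L M := IsScalarTower.of_algebraMap_eq fun a => by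
    exact congrArg (fun h => h a) hc
  exact (Module.finrank_mul_finrank _ _ _).symm

/-- Stated for ring homomorphisms because residue degrees are ranks for the structure that
`RingHom.toAlgebra` puts on residue fields. -/
theorem finrank_toAlgebra_of_bijective {K L K' L' : Type*} [Field K] [Field L] [Field K']
    [Field L'] (f : K →+* L) (f' : K' →+* L') (e : K →+* K') (e' : L →+* L')
    (he : Function.Bijective e) (he' : Function.Bijective e') (h : e'.comp f = f'.comp e) :
    @Module.finrank K L _ _ f.toAlgebra.toModule =
      @Module.finrank K' L' _ _ f'.toAlgebra.toModule := by
  let := f.toAlgebra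
  let := f'.toAlgebra
  exact Algebra.finrank_eq_of_equiv_equiv (RingEquiv.ofBijective e he)
    (RingEquiv.ofBijective e' he') h.symm

/-- Residue degrees are multiplicative. -/
theorem residueDegree_comp {X Y Z : Scheme.{u}} (f : X ⟶ Y) (g : Y ⟶ Z) (x : X) :
    (f ≫ g).residueDegree x = g.residueDegree (f x) * f.residueDegree x :=
  finrank_toAlgebra_comp (g.residueFieldMap (f x)).hom (f.residueFieldMap x).hom
    ((f ≫ g).residueFieldMap x).hom
    (congrArg CommRingCat.Hom.hom (Scheme.residueFieldMap_comp f g x))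

/-- The evaluation of global functions at a point of the spectrum of a field is bijective. -/
theorem bijective_specField_evaluation (K : Type u) [Field K] (s : Spec (.of K)) :
    Function.Bijective ((Scheme.ΓSpecIso (.of K)).inv ≫ (Spec (.of K)).Γevaluation s).hom := by
  constructor
  · exact RingHom.injective (R := K) (S := (Spec (.of K)).residueField s) _
  · change Function.Surjective ((Scheme.ΓSpecIso (.of K)).inv ≫
      (Spec (.of K)).presheaf.germ ⊤ s trivial ≫ (Spec (.of K)).residue s).hom
    rw [← Scheme.Spec.algebraMap_residueFieldIso_inv]
    let I : PrimeSpectrum K := s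
    -- The only prime of a field is zero, hence maximal, so the residue field is a quotient of `K`.
    have : I.asIdeal.IsMaximal := Ring.isField_iff_maximal_bot.1 (Field.toIsField K) |> fun h => by
      rwa [Ideal.eq_bot_of_prime I.asIdeal]
    have h1 : Function.Surjective (algebraMap K I.asIdeal.ResidueField) :=
      Ideal.algebraMap_residueField_surjective I.asIdeal
    intro y
    obtain ⟨z, rfl⟩ :=
      ((Scheme.Spec.residueFieldIso (.of K) s).symm.commRingCatIsoToRingEquiv).surjective y
    obtain ⟨a, rfl⟩ := h1 z
    exact ⟨a, rfl⟩

theorem residueDegree_specMap (F K : Type u) [Field F] [Field K] [Algebra F K]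
    (s : Spec (.of K)) :
    (Spec.map (CommRingCat.ofHom (algebraMap F K))).residueDegree s = Module.finrank F K := by
  have h : (Scheme.ΓSpecIso (.of F)).inv ≫ (Spec (.of F)).Γevaluation _ ≫
      (Spec.map (CommRingCat.ofHom (algebraMap F K))).residueFieldMap s =
      CommRingCat.ofHom (algebraMap F K) ≫
        (Scheme.ΓSpecIso (.of K)).inv ≫ (Spec (.of K)).Γevaluation s := by
    rw [Scheme.Γevaluation_naturality, Scheme.ΓSpecIso_inv_naturality_assoc]
  have := finrank_toAlgebra_of_bijective (algebraMap F K)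
    ((Spec.map (CommRingCat.ofHom (algebraMap F K))).residueFieldMap s).hom _ _
    (bijective_specField_evaluation F _) (bijective_specField_evaluation K s)
    (congrArg CommRingCat.Hom.hom h).symm
  rw [Scheme.Hom.residueDegree, ← this]
  congr 1
  exact congrArg (fun a : Algebra F K => a.toModule) (Algebra.algebra_ext _ _ fun _ => rfl)

/-- The residue field of the image point lies between `F` and `K`, and degrees are multiplicative.
-/
theorem residueDegree_dvd_finrank {F K : Type u} [Field F] [Field K] [Algebra F K]
    {X : Scheme.{u}} (p : X ⟶ Spec (.of F)) (g : Spec (.of K) ⟶ X)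
    (h : g ≫ p = Spec.map (CommRingCat.ofHom (algebraMap F K))) (s : Spec (.of K)) :
    p.residueDegree (g s) ∣ Module.finrank F K := by
  rw [← residueDegree_specMap F K s, ← h, residueDegree_comp]
  exact dvd_mul_right _ _

theorem residueDegree_mem_degreeImage {F : Type u} [Field F] {X : Scheme.{u}}
    (p : X ⟶ Spec (.of F)) (x : X) : (p.residueDegree x : ℤ) ∈ degreeImage p := by
  classical
  refine ⟨_, Function.locallyFinsuppWithin.single x 1, rfl, ?_⟩
  rw [cycleDegree, finsum_eq_single _ x]
  · simp
  · intro y hy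
    simp [hy]

/-- A morphism from a reduced scheme whose image lies in a closed set factors through the
reduced closed subscheme on that set. -/
theorem exists_lift_vanishingIdeal {X Y : Scheme.{u}} [IsReduced Y]
    (Z : TopologicalSpace.Closeds X) (g : Y ⟶ X) (h : ∀ y, g y ∈ Z) :
    ∃ g' : Y ⟶ (Scheme.IdealSheafData.vanishingIdeal Z).subscheme,
      g' ≫ (Scheme.IdealSheafData.vanishingIdeal Z).subschemeι = g := by
  -- As `Y` is reduced, its zero ideal is the vanishing ideal of all of `Y`, so `g.ker` is the
  -- vanishing ideal of the closure of the image.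
  have H : (Scheme.IdealSheafData.vanishingIdeal Z).subschemeι.ker ≤ g.ker := by
    rw [Scheme.IdealSheafData.ker_subschemeι, ← Scheme.IdealSheafData.map_bot,
      ← Scheme.nilradical_eq_bot, ← Scheme.IdealSheafData.vanishingIdeal_top,
      Scheme.IdealSheafData.map_vanishingIdeal]
    apply Scheme.IdealSheafData.vanishingIdeal_antimono
    rw [TopologicalSpace.Closeds.closure_le]
    rintro _ ⟨y, -, rfl⟩
    exact h y
  exact ⟨IsClosedImmersion.lift _ g H, IsClosedImmersion.lift_fac _ g H⟩

/-! ### Totally isotropic pairs of vectors in coordinates -/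

/-- The bilinear form with matrix `B`, with coefficients extended to an algebra. -/
noncomputable def coordForm {F : Type*} [Field F] {ι : Type*} [Fintype ι] [DecidableEq ι]
    (B : ι → ι → F) (A : Type*) [CommRing A] [Algebra F A] : (ι → A) →ₗ[A] (ι → A) →ₗ[A] A :=
  Matrix.toLinearMap₂' A (Matrix.of fun i j => algebraMap F A (B i j))

theorem coordForm_apply {F : Type*} [Field F] {ι : Type*} [Fintype ι] [DecidableEq ι]
    (B : ι → ι → F) {A : Type*} [CommRing A] [Algebra F A] (x y : ι → A) :
    coordForm B A x y = ∑ i, ∑ j, algebraMap F A (B i j) * (x i * y j) := by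
  rw [coordForm, Matrix.toLinearMap₂'_apply]
  refine Finset.sum_congr rfl fun i _ => Finset.sum_congr rfl fun j _ => ?_
  simp only [Matrix.of_apply, smul_eq_mul]
  ring

theorem coordForm_map {F : Type*} [Field F] {ι : Type*} [Fintype ι] [DecidableEq ι]
    (B : ι → ι → F) {A D : Type*} [CommRing A] [Algebra F A] [CommRing D] [Algebra F D]
    (g : A →ₐ[F] D) (x y : ι → A) :
    coordForm B D (fun i => g (x i)) (fun i => g (y i)) = g (coordForm B A x y) := by
  simp [coordForm_apply]

/-- Over the `F`-algebra `A` there are two vectors, with a nonzero two-by-two minor, that span a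
totally isotropic submodule for the quadratic form `x ↦ ∑ B i j * x i * x j`. -/
def HasIsotropicPair {F : Type*} [Field F] {ι : Type*} [Fintype ι] [DecidableEq ι]
    (B : ι → ι → F) (A : Type*) [CommRing A] [Algebra F A] : Prop :=
  ∃ x y : ι → A, (∃ i j, x i * y j - x j * y i ≠ 0) ∧ coordForm B A x x = 0 ∧
    coordForm B A y y = 0 ∧ coordForm B A x y + coordForm B A y x = 0

theorem HasIsotropicPair.map {F : Type*} [Field F] {ι : Type*} [Fintype ι] [DecidableEq ι]
    {B : ι → ι → F} {A D : Type*} [CommRing A] [Algebra F A] [CommRing D] [Algebra F D]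
    (h : HasIsotropicPair B A) (g : A →ₐ[F] D) (hg : Function.Injective g) :
    HasIsotropicPair B D := by
  obtain ⟨x, y, ⟨i, j, hij⟩, h1, h2, h3⟩ := h
  refine ⟨fun i => g (x i), fun i => g (y i), ⟨i, j, ?_⟩, ?_, ?_, ?_⟩
  · rw [← map_mul, ← map_mul, ← map_sub]
    exact (map_ne_zero_iff g hg).2 hij
  · rw [coordForm_map, h1, map_zero]
  · rw [coordForm_map, h2, map_zero]
  · rw [coordForm_map, coordForm_map, ← map_add, h3, map_zero]

/-- The matrix of a bilinear form that represents the quadratic form `φ`, in a basis. -/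
noncomputable def formMatrix {F : Type u} [Field F] {V : Type v} [AddCommGroup V] [Module F V]
    [FiniteDimensional F V] (φ : QuadraticForm F V) :
    Fin (Module.finrank F V) → Fin (Module.finrank F V) → F :=
  fun i j => φ.toBilin (Module.finBasis F V) (Module.finBasis F V i) (Module.finBasis F V j)

theorem polar_eq_toBilin_add {F : Type u} [Field F] {V : Type v} [AddCommGroup V] [Module F V]
    [FiniteDimensional F V] (φ : QuadraticForm F V) (x y : V) :
    QuadraticMap.polar φ x y = φ.toBilin (Module.finBasis F V) x y +
      φ.toBilin (Module.finBasis F V) y x := by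
  conv_lhs => rw [← QuadraticMap.toQuadraticMap_toBilin φ (Module.finBasis F V)]
  simp only [QuadraticMap.polar, LinearMap.BilinMap.toQuadraticMap_apply, map_add,
    LinearMap.add_apply]
  ring

theorem aeval_formPolynomial {F : Type u} [Field F] {V : Type v} [AddCommGroup V] [Module F V]
    [FiniteDimensional F V] (φ : QuadraticForm F V) {A : Type*} [CommRing A] [Algebra F A]
    (x : Fin (Module.finrank F V) → A) :
    MvPolynomial.aeval x (formPolynomial φ) = coordForm (formMatrix φ) A x x := by
  simp [formPolynomial, coordForm_apply, formMatrix]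

/-- The Plücker coordinates of a totally isotropic pair satisfy the equations of the variety of
totally isotropic planes. -/
theorem aeval_isotropicPlaneEquations {F : Type u} [Field F] {V : Type v} [AddCommGroup V]
    [Module F V] [FiniteDimensional F V] (φ : QuadraticForm F V) {A : Type*} [CommRing A]
    [Algebra F A] (x y : Fin (Module.finrank F V) → A)
    (hx : coordForm (formMatrix φ) A x x = 0) (hy : coordForm (formMatrix φ) A y y = 0)
    (hxy : coordForm (formMatrix φ) A x y + coordForm (formMatrix φ) A y x = 0)
    (g : MvPolynomial (Fin (Module.finrank F V) × Fin (Module.finrank F V)) F)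
    (hg : g ∈ isotropicPlaneEquations φ) :
    MvPolynomial.aeval (fun ij : Fin (Module.finrank F V) × Fin (Module.finrank F V) =>
      x ij.1 * y ij.2 - x ij.2 * y ij.1) g = 0 := by
  -- Rows of the Plücker matrix are vectors of the plane, so the last two families of equations
  -- evaluate the form on the plane.
  have hrow : ∀ k, (fun i => x k * y i - x i * y k) = x k • y - y k • x := by
    intro k
    funext i
    simp only [Pi.sub_apply, Pi.smul_apply, smul_eq_mul]
    ring
  rcases hg with ⟨i, rfl⟩ | ⟨i, j, rfl⟩ | ⟨i, j, k, l, rfl⟩ | ⟨k, rfl⟩ | ⟨k, l, rfl⟩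
  · simp
  · simp
  · simp only [map_add, map_sub, map_mul, MvPolynomial.aeval_X]
    ring
  · rw [← AlgHom.comp_apply, MvPolynomial.comp_aeval]
    simp only [MvPolynomial.aeval_X]
    rw [aeval_formPolynomial, hrow]
    simp only [map_sub, map_smul, LinearMap.sub_apply, LinearMap.smul_apply, smul_eq_mul, hx, hy]
    linear_combination (-(x k * y k)) * hxy
  · have : MvPolynomial.aeval (fun ij : Fin (Module.finrank F V) × Fin (Module.finrank F V) =>
        x ij.1 * y ij.2 - x ij.2 * y ij.1) (∑ i, ∑ j, MvPolynomial.C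
          (QuadraticMap.polar φ (Module.finBasis F V i) (Module.finBasis F V j)) *
          (MvPolynomial.X (k, i) * MvPolynomial.X (l, j))) =
        coordForm (formMatrix φ) A (x k • y - y k • x) (x l • y - y l • x) +
        coordForm (formMatrix φ) A (x l • y - y l • x) (x k • y - y k • x) := by
      rw [← hrow, ← hrow, coordForm_apply, coordForm_apply,
        Finset.sum_comm (f := fun i j => algebraMap F A (formMatrix φ i j) *
          ((x l * y i - x i * y l) * (x k * y j - x j * y k))),
        ← Finset.sum_add_distrib]
      simp only [map_sum, map_mul, MvPolynomial.aeval_X, MvPolynomial.algHom_C,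
        ← Finset.sum_add_distrib]
      refine Finset.sum_congr rfl fun i _ => Finset.sum_congr rfl fun j _ => ?_
      rw [polar_eq_toBilin_add, map_add]
      simp only [formMatrix]
      ring
    refine this.trans ?_
    simp only [map_sub, map_smul, LinearMap.sub_apply, LinearMap.smul_apply, smul_eq_mul, hx, hy]
    linear_combination (-(x k * y l) - x l * y k) * hxy

theorem isHomogeneous_isotropicPlaneEquations {F : Type u} [Field F] {V : Type v}
    [AddCommGroup V] [Module F V] [FiniteDimensional F V] (φ : QuadraticForm F V)
    (g : MvPolynomial (Fin (Module.finrank F V) × Fin (Module.finrank F V)) F)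
    (hg : g ∈ isotropicPlaneEquations φ) : ∃ n, 0 < n ∧ g.IsHomogeneous n := by
  have hX := fun i j => MvPolynomial.isHomogeneous_X F
    ((i, j) : Fin (Module.finrank F V) × Fin (Module.finrank F V))
  rcases hg with ⟨i, rfl⟩ | ⟨i, j, rfl⟩ | ⟨i, j, k, l, rfl⟩ | ⟨k, rfl⟩ | ⟨k, l, rfl⟩
  · exact ⟨1, one_pos, hX i i⟩
  · exact ⟨1, one_pos, (hX i j).add (hX j i)⟩
  · exact ⟨1 + 1, two_pos, (((hX i j).mul (hX k l)).sub ((hX i k).mul (hX j l))).add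
      ((hX i l).mul (hX j k))⟩
  · refine ⟨1 * 2, two_pos, ?_⟩
    exact (isHomogeneous_formPolynomial φ).aeval _ fun i => hX k i
  · refine ⟨0 + (1 + 1), two_pos, ?_⟩
    exact MvPolynomial.IsHomogeneous.sum _ _ _ fun i _ =>
      MvPolynomial.IsHomogeneous.sum _ _ _ fun j _ =>
        (MvPolynomial.isHomogeneous_C _ _).mul ((hX k i).mul (hX l j))

/-- A totally isotropic pair over an extension field is a point of the variety of totally isotropic
planes over that field. -/
theorem HasIsotropicPair.exists_point {F : Type u} [Field F] {V : Type v} [AddCommGroup V]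
    [Module F V] [FiniteDimensional F V] (φ : QuadraticForm F V) {K : Type u} [Field K]
    [Algebra F K] (h : HasIsotropicPair (formMatrix φ) K) :
    ∃ g : Spec (.of K) ⟶ isotropicPlaneVariety φ,
      g ≫ isotropicPlaneVarietyToSpec φ = Spec.map (CommRingCat.ofHom (algebraMap F K)) := by
  obtain ⟨x, y, ⟨i, j, hij⟩, hx, hy, hxy⟩ := h
  let e : MvPolynomial (Fin (Module.finrank F V) × Fin (Module.finrank F V)) F →ₐ[F] K :=
    MvPolynomial.aeval fun ij => x ij.1 * y ij.2 - x ij.2 * y ij.1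
  let f : MvPolynomial (Fin (Module.finrank F V) × Fin (Module.finrank F V)) F →+*
      Γ(Spec (.of K), ⊤) := (Scheme.ΓSpecIso (.of K)).inv.hom.comp e.toRingHom
  let 𝒜 := MvPolynomial.homogeneousSubmodule
    (Fin (Module.finrank F V) × Fin (Module.finrank F V)) F
  -- Condition for a morphism to `Proj`: the nonzero minor makes one Plücker coordinate a unit.
  have hf : (HomogeneousIdeal.irrelevant 𝒜).toIdeal.map f = ⊤ := by
    refine Ideal.eq_top_of_isUnit_mem _ (Ideal.mem_map_of_mem f (x := MvPolynomial.X (i, j)) ?_) ?_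
    · change MvPolynomial.X (i, j) ∈ HomogeneousIdeal.irrelevant 𝒜
      rw [HomogeneousIdeal.mem_irrelevant_iff, GradedRing.proj_apply,
        DirectSum.decompose_of_mem_ne 𝒜 (i := 1) (MvPolynomial.isHomogeneous_X F (i, j))
          one_ne_zero]
    · have : IsUnit (e (MvPolynomial.X (i, j))) := by
        refine IsUnit.mk0 _ ?_
        simpa [e] using hij
      exact this.map (Scheme.ΓSpecIso (.of K)).inv.hom
  let g₀ := Proj.fromOfGlobalSections 𝒜 f hf
  have hmem : ∀ s, g₀ s ∈ isotropicPlaneLocus φ := by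
    intro s g hg
    obtain ⟨n, hn, hgn⟩ := isHomogeneous_isotropicPlaneEquations φ g hg
    by_contra hc
    have h1 : s ∈ g₀ ⁻¹ᵁ Proj.basicOpen 𝒜 g := hc
    have h0 : f g = 0 := by
      have : e g = 0 := aeval_isotropicPlaneEquations φ x y hx hy hxy g hg
      change (Scheme.ΓSpecIso (.of K)).inv.hom (e g) = 0
      rw [this, map_zero]
    rw [Proj.fromOfGlobalSections_preimage_basicOpen 𝒜 f hf hn hgn, h0,
      Scheme.basicOpen_zero] at h1
    exact h1
  have hg₀ : g₀ ≫ pluckerSpaceToSpec F (Module.finrank F V) =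
      Spec.map (CommRingCat.ofHom (algebraMap F K)) := by
    have hc : CommRingCat.ofHom (algebraMap F (𝒜 0)) ≫
        CommRingCat.ofHom (f.comp (algebraMap (𝒜 0) _)) ≫ (Scheme.ΓSpecIso (.of K)).hom =
        CommRingCat.ofHom (algebraMap F K) := by
      ext a
      change (Scheme.ΓSpecIso (.of K)).hom.hom ((Scheme.ΓSpecIso (.of K)).inv.hom
        (e (algebraMap F _ a))) = _
      rw [e.commutes]
      exact congrArg (fun h => h.hom (algebraMap F K a)) (Scheme.ΓSpecIso (.of K)).inv_hom_id
    rw [pluckerSpaceToSpec, Proj.fromOfGlobalSections_toSpecZero_assoc,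
      ← SpecMap_ΓSpecIso_hom, ← hc, Spec.map_comp, Spec.map_comp, Category.assoc]
  obtain ⟨g', hg'⟩ := exists_lift_vanishingIdeal (isotropicPlaneLocus φ) g₀ hmem
  refine ⟨g', Eq.trans ?_ hg₀⟩
  exact (Category.assoc _ _ _).symm.trans (congrArg (· ≫ pluckerSpaceToSpec F _) hg')

/-- If the degree of every cycle on the variety of totally isotropic planes is divisible by four,
there are no totally isotropic planes over extensions of degree at most two. -/
theorem not_hasIsotropicPair_of_degreeImage {F : Type u} [Field F] {V : Type v} [AddCommGroup V]
    [Module F V] [FiniteDimensional F V] (φ : QuadraticForm F V)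
    (hdeg : degreeImage (isotropicPlaneVarietyToSpec φ) = {d : ℤ | 4 ∣ d}) (K : Type u) [Field K]
    [Algebra F K] (h0 : 0 < Module.finrank F K) (h2 : Module.finrank F K ≤ 2) :
    ¬ HasIsotropicPair (formMatrix φ) K := by
  intro h
  obtain ⟨g, hg⟩ := h.exists_point
  let s : Spec (.of K) := (⊥ : PrimeSpectrum K)
  have h1 := residueDegree_dvd_finrank _ g hg s
  have h3 := residueDegree_mem_degreeImage (isotropicPlaneVarietyToSpec φ) (g s)
  rw [hdeg, Set.mem_ofPred_eq] at h3
  have h4 : 4 ∣ (isotropicPlaneVarietyToSpec φ).residueDegree (g s) := by exact_mod_cast h3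
  -- `h0` excludes infinite extensions, whose `finrank` is zero.
  have := Nat.le_of_dvd h0 (h4.trans h1)
  omega

/-! ### Specialization of totally isotropic pairs -/

/-- In a Noetherian domain, a nonzero vector is a power of `π` times a vector that has a coordinate
not divisible by `π`. -/
theorem exists_pow_smul_not_dvd {A ι : Type*} [CommRing A] [IsDomain A] [IsNoetherianRing A]
    {π : A} (hπ : ¬ IsUnit π) (x : ι → A) (hx : x ≠ 0) :
    ∃ (m : ℕ) (z : ι → A), x = π ^ m • z ∧ ∃ i, ¬ π ∣ z i := by
  obtain ⟨i, hi⟩ := Function.ne_iff.1 hx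
  have hfin : ∃ n, ¬ π ^ (n + 1) ∣ x i := FiniteMultiplicity.of_not_isUnit hπ hi
  obtain ⟨n, hn⟩ := hfin
  clear hi hx
  -- Induction on a bound for the multiplicity of `π` in one fixed nonzero coordinate; dividing the
  -- vector by `π` lowers it.
  induction n generalizing x with
  | zero => exact ⟨0, x, by simp, i, by simpa using hn⟩
  | succ n ih =>
    by_cases h : ∀ j, π ∣ x j
    · choose z hz using h
      have hz' : x = π • z := funext hz
      have hd : ¬ π ^ (n + 1) ∣ z i := fun hd => hn (by
        rw [hz i, pow_succ' π (n + 1)]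
        exact mul_dvd_mul_left _ hd)
      obtain ⟨m, z', h1, h2⟩ := ih z hd
      exact ⟨m + 1, z', by rw [hz', h1, smul_smul, pow_succ'], h2⟩
    · push Not at h
      exact ⟨0, x, by simp, h⟩

/-- Totally isotropic pairs over a Noetherian domain specialize along a prime divisor. -/
theorem HasIsotropicPair.specialize {F : Type*} [Field F] {ι : Type*} [Fintype ι] [DecidableEq ι]
    {B : ι → ι → F} {A D : Type*} [CommRing A] [IsDomain A] [IsNoetherianRing A] [Algebra F A]
    [CommRing D] [IsDomain D] [Algebra F D] (h : HasIsotropicPair B A) (g : A →ₐ[F] D) (π : A)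
    (hg : ∀ a, g a = 0 ↔ π ∣ a) : HasIsotropicPair B D := by
  by_cases hπ0 : π = 0
  · refine h.map g ((injective_iff_map_eq_zero g).2 fun a ha => ?_)
    simpa [hπ0] using (hg a).1 ha
  have hπ : ¬ IsUnit π := fun hu => one_ne_zero (α := D) (by
    rw [← map_one g]
    exact (hg 1).2 hu.dvd)
  obtain ⟨x, y, ⟨k, l, hkl⟩, h1, h2, h3⟩ := h
  have hx0 : x ≠ 0 := by
    rintro rfl
    simp at hkl
  obtain ⟨m, z, hxz, i, hi⟩ := exists_pow_smul_not_dvd hπ x hx0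
  have hpow : π ^ m ≠ 0 := pow_ne_zero _ hπ0
  have hzi : z i ≠ 0 := fun h0 => hi (h0 ▸ dvd_zero π)
  have hzz : coordForm B A z z = 0 := by
    rw [hxz] at h1
    simpa [hpow] using h1
  have hzy : coordForm B A z y + coordForm B A y z = 0 := by
    rw [hxz] at h3
    simp only [map_smul, LinearMap.smul_apply, ← smul_add] at h3
    simpa [hpow] using h3
  -- Reducing `z` and `y` directly could make them proportional modulo `π`. Eliminating the `i`-th
  -- coordinate first and then dividing by powers of `π` gives `w` with `w i = 0` and some `w j`
  -- prime to the obstruction: the minor is then `z i * w j`, nonzero in the domain `D`.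
  have hw0 : z i • y - y i • z ≠ 0 := by
    intro h0
    refine hkl ?_
    have hk := congrFun h0 k
    have hl := congrFun h0 l
    simp only [Pi.sub_apply, Pi.smul_apply, smul_eq_mul, Pi.zero_apply] at hk hl
    have : z i * (z k * y l - z l * y k) = 0 := by linear_combination z k * hl - z l * hk
    have h4 := (mul_eq_zero.1 this).resolve_left hzi
    rw [hxz]
    simp only [Pi.smul_apply, smul_eq_mul]
    linear_combination π ^ m * h4
  obtain ⟨m', w, hw, j, hj⟩ := exists_pow_smul_not_dvd hπ _ hw0
  have hpow' : π ^ m' ≠ 0 := pow_ne_zero _ hπ0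
  have hwi : w i = 0 := by
    have := congrFun hw i
    simp only [Pi.sub_apply, Pi.smul_apply, smul_eq_mul] at this
    rw [mul_comm, sub_self] at this
    simpa [hpow'] using this.symm
  have hww : coordForm B A w w = 0 := by
    have : coordForm B A (π ^ m' • w) (π ^ m' • w) = 0 := by
      rw [← hw]
      simp only [map_sub, map_smul, LinearMap.sub_apply, LinearMap.smul_apply, smul_eq_mul, hzz, h2]
      linear_combination (-(z i * y i)) * hzy
    simpa [hpow'] using this
  have hzw : coordForm B A z w + coordForm B A w z = 0 := by
    have : π ^ m' * (coordForm B A z w + coordForm B A w z) = 0 := by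
      have e : π ^ m' * (coordForm B A z w + coordForm B A w z) =
          coordForm B A z (π ^ m' • w) + coordForm B A (π ^ m' • w) z := by
        simp only [map_smul, LinearMap.smul_apply, smul_eq_mul]
        ring
      rw [e, ← hw]
      simp only [map_sub, map_smul, LinearMap.sub_apply, LinearMap.smul_apply, smul_eq_mul, hzz]
      linear_combination z i * hzy
    exact (mul_eq_zero.1 this).resolve_left hpow'
  refine ⟨fun k => g (z k), fun k => g (w k), ⟨i, j, ?_⟩, ?_, ?_, ?_⟩
  · simp only [hwi, map_zero, mul_zero, sub_zero]
    exact mul_ne_zero (fun h => hi ((hg _).1 h)) (fun h => hj ((hg _).1 h))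
  · rw [coordForm_map, hzz, map_zero]
  · rw [coordForm_map, hww, map_zero]
  · rw [coordForm_map, coordForm_map, ← map_add, hzw, map_zero]

/-- Totally isotropic pairs over the fraction field of a domain come from the domain. -/
theorem HasIsotropicPair.of_fractionRing {F : Type*} [Field F] {ι : Type*} [Fintype ι]
    [DecidableEq ι] {B : ι → ι → F} {A L : Type*} [CommRing A] [IsDomain A] [Algebra F A]
    [Field L] [Algebra A L] [IsFractionRing A L] [Algebra F L] [IsScalarTower F A L]
    (h : HasIsotropicPair B L) : HasIsotropicPair B A := by
  obtain ⟨x, y, ⟨k, l, hkl⟩, h1, h2, h3⟩ := h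
  have hinj : Function.Injective (IsScalarTower.toAlgHom F A L) := IsFractionRing.injective A L
  -- Scaling the two vectors by nonzero factors preserves all conditions on the pair, so each is
  -- cleared of denominators separately.
  have hclear : ∀ x : ι → L, ∃ (a : L) (z : ι → A), a ≠ 0 ∧
      (fun i => IsScalarTower.toAlgHom F A L (z i)) = a • x := by
    intro x
    obtain ⟨b, hb⟩ := IsLocalization.exist_integer_multiples_of_finite (nonZeroDivisors A) x
    choose z hz using hb
    refine ⟨algebraMap A L b, z, IsFractionRing.to_map_ne_zero_of_mem_nonZeroDivisors b.2, ?_⟩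
    funext i
    rw [Pi.smul_apply, smul_eq_mul, ← Algebra.smul_def]
    exact hz i
  obtain ⟨a, z, ha, hz⟩ := hclear x
  obtain ⟨b, w, hb, hw⟩ := hclear y
  refine ⟨z, w, ⟨k, l, fun h0 => hkl ?_⟩, hinj ?_, hinj ?_, hinj ?_⟩
  · have hzi := fun i => congrFun hz i
    have hwi := fun i => congrFun hw i
    have := congrArg (IsScalarTower.toAlgHom F A L) h0
    simp only [map_sub, map_mul, hzi, hwi, Pi.smul_apply, smul_eq_mul, map_zero] at this
    have h5 : (a * b) * (x k * y l - x l * y k) = 0 := by linear_combination this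
    exact (mul_eq_zero.1 h5).resolve_left (mul_ne_zero ha hb)
  · rw [← coordForm_map, hz]
    simp [h1]
  · rw [← coordForm_map, hw]
    simp [h2]
  · rw [map_add, ← coordForm_map, ← coordForm_map, hz, hw, map_zero]
    simp only [map_smul, LinearMap.smul_apply, smul_eq_mul]
    linear_combination a * b * h3

/-! ### Hyperplane sections of affine quadric cones -/

/-- A homogeneous polynomial of degree two in at least two variables without nontrivial zeros is
prime. -/
theorem MvPolynomial.IsHomogeneous.prime_of_anisotropic {F : Type*} [Field F] {N : ℕ}
    {f : MvPolynomial (Fin N) F} (hf : f.IsHomogeneous 2)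
    (hne : ∀ x : Fin N → F, x ≠ 0 → MvPolynomial.eval x f ≠ 0) (h2 : 2 ≤ N) : Prime f := by
  have hq0 : f ≠ 0 := by
    intro h0
    have hx : (Pi.single ⟨0, by omega⟩ 1 : Fin N → F) ≠ 0 := by
      simp
    exact hne _ hx (by rw [h0, map_zero])
  have hdeg : (f).totalDegree = 2 :=
    (hf).totalDegree hq0
  have hunit : ∀ a : MvPolynomial (Fin N) F, a ≠ 0 → a.totalDegree = 0 →
      IsUnit a := by
    intro a ha h0
    rw [MvPolynomial.totalDegree_eq_zero_iff_eq_C] at h0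
    rw [h0] at ha ⊢
    have hc : MvPolynomial.coeff 0 a ≠ 0 := by
      intro hc
      exact ha (by rw [hc, map_zero])
    exact (IsUnit.mk0 _ hc).map MvPolynomial.C
  refine Irreducible.prime ⟨fun hu => ?_, ?_⟩
  · have := (MvPolynomial.isUnit_iff_totalDegree_of_isReduced.1 hu).2
    omega
  · intro a b hab
    have ha0 : a ≠ 0 := by rintro rfl; exact hq0 (by rw [hab, zero_mul])
    have hb0 : b ≠ 0 := by rintro rfl; exact hq0 (by rw [hab, mul_zero])
    have hd := MvPolynomial.totalDegree_mul_of_isDomain ha0 hb0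
    rw [← hab, hdeg] at hd
    rcases Nat.eq_zero_or_pos a.totalDegree with h1 | h1
    · exact Or.inl (hunit a ha0 h1)
    rcases Nat.eq_zero_or_pos b.totalDegree with h3 | h3
    · exact Or.inr (hunit b hb0 h3)
    -- Both factors have degree one. Since `f` is homogeneous, it is the product of their linear
    -- parts, and a linear form in at least two variables has a nontrivial zero.
    exfalso
    have key : ∀ c : MvPolynomial (Fin N) F, c.totalDegree = 1 →
        c = MvPolynomial.homogeneousComponent 0 c + MvPolynomial.homogeneousComponent 1 c := by
      intro c hc
      conv_lhs => rw [← MvPolynomial.sum_homogeneousComponent c, hc]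
      simp [Finset.sum_range_succ]
    have ea := key a (by omega)
    have eb := key b (by omega)
    have ha := MvPolynomial.homogeneousComponent_isHomogeneous 0 a
    have ha' := MvPolynomial.homogeneousComponent_isHomogeneous 1 a
    have hb := MvPolynomial.homogeneousComponent_isHomogeneous 0 b
    have hb' := MvPolynomial.homogeneousComponent_isHomogeneous 1 b
    set a₀ := MvPolynomial.homogeneousComponent 0 a
    set a₁ := MvPolynomial.homogeneousComponent 1 a
    set b₀ := MvPolynomial.homogeneousComponent 0 b
    set b₁ := MvPolynomial.homogeneousComponent 1 b
    have hab' : f = a₁ * b₁ := by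
      have e : f = a₀ * b₀ + (a₀ * b₁ + a₁ * b₀) + a₁ * b₁ := by
        rw [hab, ea, eb]; ring
      have e2 := congrArg (MvPolynomial.homogeneousComponent 2) e
      rw [map_add, map_add,
        MvPolynomial.homogeneousComponent_of_mem (hf),
        MvPolynomial.homogeneousComponent_of_mem (ha.mul hb),
        MvPolynomial.homogeneousComponent_of_mem
          (((ha.mul hb').add (ha'.mul hb) : MvPolynomial.IsHomogeneous _ 1)),
        MvPolynomial.homogeneousComponent_of_mem (ha'.mul hb')] at e2
      simpa using e2
    obtain ⟨L, hL⟩ : ∃ L : (Fin N → F) →ₗ[F] F,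
        ∀ x, MvPolynomial.eval x a₁ = L x := by
      have hm : a₁ ∈ Submodule.span F (Set.range MvPolynomial.X) := by
        rw [← MvPolynomial.homogeneousSubmodule_one_eq_span_X]
        exact ha'
      clear_value a₁
      clear ea ha' hab'
      induction hm using Submodule.span_induction with
      | mem y hy =>
        obtain ⟨i, rfl⟩ := hy
        exact ⟨LinearMap.proj i, fun x => by simp⟩
      | zero => exact ⟨0, fun x => by simp⟩
      | add y z _ _ hy hz =>
        obtain ⟨L, hL⟩ := hy
        obtain ⟨M, hM⟩ := hz
        exact ⟨L + M, fun x => by simp [hL, hM]⟩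
      | smul c y _ hy =>
        obtain ⟨L, hL⟩ := hy
        exact ⟨c • L, fun x => by simp [hL]⟩
    have hker : LinearMap.ker L ≠ ⊥ := by
      refine LinearMap.ker_ne_bot_of_finrank_lt ?_
      rw [Module.finrank_self, Module.finrank_fin_fun]
      omega
    obtain ⟨x, hx, hx0⟩ := Submodule.exists_mem_ne_zero_of_ne_bot hker
    refine hne x hx0 ?_
    rw [hab', map_mul, hL, LinearMap.mem_ker.1 hx, zero_mul]

/-- The quadratic polynomial `∑ C i j * x i * x j`. -/
noncomputable def quadricPolynomial {F : Type*} [Field F] {N : ℕ} (C : Fin N → Fin N → F) :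
    MvPolynomial (Fin N) F :=
  ∑ i, ∑ j, MvPolynomial.C (C i j) * (MvPolynomial.X i * MvPolynomial.X j)

theorem isHomogeneous_quadricPolynomial {F : Type*} [Field F] {N : ℕ} (C : Fin N → Fin N → F) :
    (quadricPolynomial C).IsHomogeneous 2 := by
  refine MvPolynomial.IsHomogeneous.sum _ _ _ fun i _ =>
    MvPolynomial.IsHomogeneous.sum _ _ _ fun j _ => ?_
  simpa using (MvPolynomial.isHomogeneous_C _ _).mul
    ((MvPolynomial.isHomogeneous_X F i).mul (MvPolynomial.isHomogeneous_X F j))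

theorem isDomain_quotient_quadricPolynomial {F : Type*} [Field F] {N : ℕ}
    (C : Fin N → Fin N → F) (h2 : 2 ≤ N)
    (hC : ∀ x, x ≠ 0 → MvPolynomial.eval x (quadricPolynomial C) ≠ 0) :
    IsDomain (MvPolynomial (Fin N) F ⧸ Ideal.span {quadricPolynomial C}) := by
  have hp := (isHomogeneous_quadricPolynomial C).prime_of_anisotropic hC h2
  have := (Ideal.span_singleton_prime hp.ne_zero).2 hp
  exact Ideal.Quotient.isDomain _

/-- An algebra endomorphism that fixes the variables modulo `d` is the identity modulo `d`. -/
theorem MvPolynomial.dvd_sub_apply_of_dvd_X {F σ : Type*} [CommRing F]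
    (f : MvPolynomial σ F →ₐ[F] MvPolynomial σ F) (d : MvPolynomial σ F)
    (h : ∀ i, d ∣ MvPolynomial.X i - f (MvPolynomial.X i)) (p : MvPolynomial σ F) :
    d ∣ p - f p := by
  have key : Ideal.Quotient.mkₐ F (Ideal.span {d}) =
      (Ideal.Quotient.mkₐ F (Ideal.span {d})).comp f := by
    refine MvPolynomial.algHom_ext fun i => ?_
    exact Ideal.Quotient.eq.2 (Ideal.mem_span_singleton.2 (h i))
  exact Ideal.mem_span_singleton.1 (Ideal.Quotient.eq.1 (congrArg (fun g => g p) key))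

/-- Specialization of totally isotropic pairs from a hypersurface `q = 0` to a hyperplane section
`q = d = 0`. -/
theorem HasIsotropicPair.specialize_quotient {F : Type*} [Field F] {ι : Type*} [Fintype ι]
    [DecidableEq ι] {B : ι → ι → F} {S T : Type*} [CommRing S] [IsNoetherianRing S] [Algebra F S]
    [CommRing T] [Algebra F T] (f : S →ₐ[F] T) (s : T →ₐ[F] S) (d q : S) (hd : f d = 0)
    (hs : ∀ p, d ∣ p - s (f p)) [IsDomain (S ⧸ Ideal.span {q})]
    [IsDomain (T ⧸ Ideal.span {f q})] (h : HasIsotropicPair B (S ⧸ Ideal.span {q})) :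
    HasIsotropicPair B (T ⧸ Ideal.span {f q}) := by
  let g : S ⧸ Ideal.span {q} →ₐ[F] T ⧸ Ideal.span {f q} :=
    Ideal.Quotient.liftₐ _ ((Ideal.Quotient.mkₐ F (Ideal.span {f q})).comp f) (by
      intro a ha
      obtain ⟨c, rfl⟩ := Ideal.mem_span_singleton.1 ha
      refine Ideal.Quotient.eq_zero_iff_mem.2 (Ideal.mem_span_singleton.2 ?_)
      exact ⟨f c, map_mul f q c⟩)
  have hgmk : ∀ p, g (Ideal.Quotient.mk _ p) = Ideal.Quotient.mk _ (f p) := fun p => rfl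
  refine h.specialize g (Ideal.Quotient.mk _ d) fun a => ?_
  obtain ⟨p, rfl⟩ := Ideal.Quotient.mk_surjective a
  constructor
  · intro h0
    rw [hgmk, Ideal.Quotient.eq_zero_iff_mem, Ideal.mem_span_singleton] at h0
    obtain ⟨r, hr⟩ := h0
    obtain ⟨t, ht⟩ := hs p
    obtain ⟨t', ht'⟩ := hs q
    rw [hr, map_mul] at ht
    -- Modulo `d`, `p ≡ s (f p) = s (f q) * s r ≡ q * s r`; the witness collects the two multiples
    -- of `d`.
    refine ⟨Ideal.Quotient.mk _ (t - t' * s r), ?_⟩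
    rw [← map_mul]
    refine Ideal.Quotient.eq.2 (Ideal.mem_span_singleton.2 ⟨s r, ?_⟩)
    linear_combination ht - s r * ht'
  · rintro ⟨c, hc⟩
    rw [hc, map_mul, hgmk, hd, map_zero, zero_mul]

/-- Totally isotropic pairs over the affine cone of an anisotropic quadric specialize to a quadratic
extension of the base field. -/
theorem HasIsotropicPair.exists_quadratic {F : Type u} [Field F] {ι : Type*} [Fintype ι]
    [DecidableEq ι] {B : ι → ι → F} {N : ℕ} (h2 : 2 ≤ N) (C : Fin N → Fin N → F)
    (hC : ∀ x, x ≠ 0 → MvPolynomial.eval x (quadricPolynomial C) ≠ 0)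
    (h : HasIsotropicPair B (MvPolynomial (Fin N) F ⧸ Ideal.span {quadricPolynomial C})) :
    ∃ (K : Type u) (_ : Field K) (_ : Algebra F K),
      Module.finrank F K = 2 ∧ HasIsotropicPair B K := by
  induction N, h2 using Nat.le_induction with
  | base =>
    have := isDomain_quotient_quadricPolynomial C le_rfl hC
    -- In two variables the cut is the affine line `x₁ = 1`. The form becomes a quadratic polynomial
    -- without roots, so the quotient is a quadratic field extension.
    let f : MvPolynomial (Fin 2) F →ₐ[F] Polynomial F :=
      MvPolynomial.aeval ![Polynomial.X, 1]
    let s : Polynomial F →ₐ[F] MvPolynomial (Fin 2) F := Polynomial.aeval (MvPolynomial.X 0)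
    have hfq : f (quadricPolynomial C) = Polynomial.C (C 0 0) * Polynomial.X ^ 2 +
        Polynomial.C (C 0 1 + C 1 0) * Polynomial.X + Polynomial.C (C 1 1) := by
      simp only [f, quadricPolynomial, Fin.sum_univ_two, map_add, map_mul, MvPolynomial.aeval_X,
        MvPolynomial.algHom_C, Polynomial.algebraMap_eq, Matrix.cons_val_zero, Matrix.cons_val_one]
      ring
    have h00 : C 0 0 ≠ 0 := by
      have := hC ![1, 0] (fun h => by simpa using congrFun h 0)
      simpa [quadricPolynomial, Fin.sum_univ_two] using this
    have hdeg : (f (quadricPolynomial C)).natDegree = 2 := by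
      rw [hfq]
      exact Polynomial.natDegree_quadratic h00
    have hne : f (quadricPolynomial C) ≠ 0 := by
      intro h0
      simp [h0] at hdeg
    have hroot : ∀ t, (f (quadricPolynomial C)).eval t ≠ 0 := by
      intro t ht
      refine hC ![t, 1] (fun h => by simpa using congrFun h 1) ?_
      rw [← ht, hfq]
      simp only [quadricPolynomial, Fin.sum_univ_two, map_add, map_mul, MvPolynomial.eval_X,
        MvPolynomial.eval_C, Matrix.cons_val_zero, Matrix.cons_val_one, Polynomial.eval_add,
        Polynomial.eval_mul, Polynomial.eval_C, Polynomial.eval_X, Polynomial.eval_pow]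
      ring
    have hirr : Irreducible (f (quadricPolynomial C)) := by
      rw [Polynomial.irreducible_iff_roots_eq_zero_of_degree_le_three hdeg.ge (by omega)]
      exact Multiset.eq_zero_of_forall_notMem fun t ht =>
        hroot t (Polynomial.isRoot_of_mem_roots ht)
    have : Fact (Irreducible (f (quadricPolynomial C))) := ⟨hirr⟩
    refine ⟨AdjoinRoot (f (quadricPolynomial C)), inferInstance, inferInstance, ?_, ?_⟩
    · rw [(AdjoinRoot.powerBasis hne).finrank, AdjoinRoot.powerBasis_dim, hdeg]
    · have : IsDomain (Polynomial F ⧸ Ideal.span {f (quadricPolynomial C)}) :=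
        inferInstanceAs (IsDomain (AdjoinRoot (f (quadricPolynomial C))))
      refine h.specialize_quotient f s (MvPolynomial.X 1 - 1) _ (by simp [f]) fun p => ?_
      refine MvPolynomial.dvd_sub_apply_of_dvd_X (s.comp f) _ (fun i => ?_) p
      fin_cases i
      · simp [f, s]
      · simp [f, s]
  | succ N h2 ih =>
    have := isDomain_quotient_quadricPolynomial C (by omega) hC
    -- Cut by `x₀ = 0`; the restricted form stays anisotropic.
    let f : MvPolynomial (Fin (N + 1)) F →ₐ[F] MvPolynomial (Fin N) F :=
      MvPolynomial.aeval (Fin.cases 0 MvPolynomial.X)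
    let s : MvPolynomial (Fin N) F →ₐ[F] MvPolynomial (Fin (N + 1)) F :=
      MvPolynomial.rename Fin.succ
    have hfq : f (quadricPolynomial C) = quadricPolynomial fun i j => C i.succ j.succ := by
      simp [f, quadricPolynomial, Fin.sum_univ_succ]
    have hC' : ∀ x, x ≠ 0 →
        MvPolynomial.eval x (quadricPolynomial fun i j => C i.succ j.succ) ≠ 0 := by
      intro x hx h0
      refine hC (Fin.cons 0 x) (fun h => hx (funext fun i => ?_)) ?_
      · simpa using congrFun h i.succ
      · refine Eq.trans ?_ h0
        simp [quadricPolynomial, Fin.sum_univ_succ]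
    have := isDomain_quotient_quadricPolynomial _ h2 hC'
    refine ih _ hC' ?_
    rw [← hfq] at this ⊢
    refine h.specialize_quotient f s (MvPolynomial.X 0) _ (by simp [f]) fun p => ?_
    refine MvPolynomial.dvd_sub_apply_of_dvd_X (s.comp f) _ (fun i => ?_) p
    refine Fin.cases ?_ (fun i => ?_) i
    · simp [f, s]
    · simp [f, s]

/-! ### Base change of quadratic forms -/

section BaseChange

variable {F : Type u} [Field F] {V : Type v} [AddCommGroup V] [Module F V] [FiniteDimensional F V]
  (φ : QuadraticForm F V) (K : Type u) [Field K] [Algebra F K]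

theorem polar_formBaseChange (s t : K ⊗[F] V) :
    QuadraticMap.polar (formBaseChange φ K) s t =
      LinearMap.BilinForm.baseChange K (φ.toBilin (Module.finBasis F V)) s t +
      LinearMap.BilinForm.baseChange K (φ.toBilin (Module.finBasis F V)) t s := by
  simp only [formBaseChange, QuadraticMap.polar, LinearMap.BilinMap.toQuadraticMap_apply, map_add,
    LinearMap.add_apply]
  ring

theorem baseChange_toBilin_eq_coordForm (s t : K ⊗[F] V) :
    LinearMap.BilinForm.baseChange K (φ.toBilin (Module.finBasis F V)) s t =
      coordForm (formMatrix φ) K (((Module.finBasis F V).baseChange K).repr s)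
        (((Module.finBasis F V).baseChange K).repr t) := by
  conv_lhs => rw [← ((Module.finBasis F V).baseChange K).sum_repr s,
    ← ((Module.finBasis F V).baseChange K).sum_repr t]
  rw [coordForm_apply]
  simp only [map_sum, LinearMap.sum_apply, map_smul, LinearMap.smul_apply, smul_eq_mul,
    Module.Basis.baseChange_apply, LinearMap.BilinForm.baseChange_tmul, formMatrix, Finset.mul_sum]
  rw [Finset.sum_comm]
  refine Finset.sum_congr rfl fun i _ => Finset.sum_congr rfl fun j _ => ?_
  rw [Algebra.smul_def]
  ring

theorem formBaseChange_eq_coordForm (t : K ⊗[F] V) :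
    formBaseChange φ K t = coordForm (formMatrix φ) K
      (((Module.finBasis F V).baseChange K).repr t)
      (((Module.finBasis F V).baseChange K).repr t) :=
  baseChange_toBilin_eq_coordForm φ K t t

theorem toBilin_self_apply (x : V) : φ.toBilin (Module.finBasis F V) x x = φ x := by
  conv_rhs => rw [← QuadraticMap.toQuadraticMap_toBilin φ (Module.finBasis F V)]
  rfl

/-- Together with `polar_formBaseChange_tmul` this determines the base change by `φ` and its polar
form alone, so the chosen bilinear form drops out. -/
theorem formBaseChange_tmul (a : K) (x : V) :
    formBaseChange φ K (a ⊗ₜ x) = a * a * algebraMap F K (φ x) := by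
  rw [formBaseChange, LinearMap.BilinMap.toQuadraticMap_apply,
    LinearMap.BilinForm.baseChange_tmul, toBilin_self_apply, Algebra.smul_def]
  ring

theorem polar_formBaseChange_tmul (a b : K) (x y : V) :
    QuadraticMap.polar (formBaseChange φ K) (a ⊗ₜ x) (b ⊗ₜ y) =
      a * b * algebraMap F K (QuadraticMap.polar φ x y) := by
  rw [polar_formBaseChange, LinearMap.BilinForm.baseChange_tmul,
    LinearMap.BilinForm.baseChange_tmul, polar_eq_toBilin_add, Algebra.smul_def, Algebra.smul_def,
    map_add]
  ring

variable {φ K}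

/-- Two linearly independent vectors that span a totally isotropic plane form a totally isotropic
pair in coordinates. -/
theorem hasIsotropicPair_of_formBaseChange {s t : K ⊗[F] V} (hs : s ≠ 0)
    (hst : ∀ c : K, t ≠ c • s) (h1 : formBaseChange φ K s = 0) (h2 : formBaseChange φ K t = 0)
    (h3 : QuadraticMap.polar (formBaseChange φ K) s t = 0) :
    HasIsotropicPair (formMatrix φ) K := by
  rw [formBaseChange_eq_coordForm] at h1 h2
  rw [polar_formBaseChange, baseChange_toBilin_eq_coordForm, baseChange_toBilin_eq_coordForm] at h3
  refine ⟨_, _, ?_, h1, h2, h3⟩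
  by_contra! hc
  obtain ⟨i, hi⟩ : ∃ i, ((Module.finBasis F V).baseChange K).repr s i ≠ 0 := by
    by_contra! h0
    exact hs (((Module.finBasis F V).baseChange K).repr.map_eq_zero_iff.1 (Finsupp.ext h0))
  refine hst (((Module.finBasis F V).baseChange K).repr t i /
    ((Module.finBasis F V).baseChange K).repr s i)
    (((Module.finBasis F V).baseChange K).ext_elem fun j => ?_)
  rw [map_smul, Finsupp.smul_apply, smul_eq_mul, div_mul_eq_mul_div, eq_div_iff hi]
  linear_combination hc i j

/-- Base change is functorial for isometric linear maps. -/
theorem formBaseChange_baseChange_apply {U : Type*} [AddCommGroup U] [Module F U]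
    [FiniteDimensional F U] {ψ : QuadraticForm F U} (l : U →ₗ[F] V) (hl : ∀ x, φ (l x) = ψ x)
    (t : K ⊗[F] U) : formBaseChange φ K (l.baseChange K t) = formBaseChange ψ K t := by
  have hpol : ∀ s t : K ⊗[F] U, QuadraticMap.polar (formBaseChange φ K) (l.baseChange K s)
      (l.baseChange K t) = QuadraticMap.polar (formBaseChange ψ K) s t := by
    intro s t
    induction s using TensorProduct.induction_on with
    | zero => simp
    | add s₁ s₂ h₁ h₂ => rw [map_add, QuadraticMap.polar_add_left, QuadraticMap.polar_add_left,
        h₁, h₂]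
    | tmul a x =>
      induction t using TensorProduct.induction_on with
      | zero => simp
      | add t₁ t₂ h₁ h₂ => rw [map_add, QuadraticMap.polar_add_right,
          QuadraticMap.polar_add_right, h₁, h₂]
      | tmul b y =>
        rw [LinearMap.baseChange_tmul, LinearMap.baseChange_tmul, polar_formBaseChange_tmul,
          polar_formBaseChange_tmul]
        simp only [QuadraticMap.polar, ← map_add l, hl]
  induction t using TensorProduct.induction_on with
  | zero => simp
  | add s t hs ht =>
    rw [map_add, QuadraticMap.map_add (formBaseChange φ K),
      QuadraticMap.map_add (formBaseChange ψ K), hs, ht, hpol]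
  | tmul a x => rw [LinearMap.baseChange_tmul, formBaseChange_tmul, formBaseChange_tmul, hl]

/-- A nondegenerate form stays anisotropic on its radical over every extension field. -/
theorem IsNondegenerateForm.eq_zero_of_polar_eq_zero (hφ : IsNondegenerateForm φ) {t : K ⊗[F] V}
    (h0 : formBaseChange φ K t = 0)
    (hp : ∀ s, QuadraticMap.polar (formBaseChange φ K) t s = 0) : t = 0 := by
  let ℬ := Module.Basis.ofVectorSpace F K
  obtain ⟨c, rfl⟩ := TensorProduct.eq_repr_basis_left ℬ t
  -- Expand `t` in an `F`-basis of `K`. Pairing with `1 ⊗ w` and comparing coefficients puts every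
  -- `c a` in the radical of `φ`.
  have hc : ∀ a, c a ∈ LinearMap.ker φ.polarBilin := by
    intro a
    rw [LinearMap.mem_ker]
    ext w
    have h1 := hp (1 ⊗ₜ w)
    have h2 : c.sum (fun i n => φ.polarBilin n w • ℬ i) = 0 := by
      rw [← h1]
      change _ = QuadraticMap.polarBilin (formBaseChange φ K) _ _
      rw [Finsupp.sum, Finsupp.sum, map_sum, LinearMap.sum_apply]
      refine Finset.sum_congr rfl fun i _ => ?_
      rw [QuadraticMap.polarBilin_apply_apply, QuadraticMap.polarBilin_apply_apply,
        polar_formBaseChange_tmul, Algebra.smul_def]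
      ring
    by_cases ha : a ∈ c.support
    · exact linearIndependent_iff'.1 ℬ.linearIndependent c.support
        (fun i => φ.polarBilin (c i) w) h2 a ha
    · rw [Finsupp.notMem_support_iff.1 ha, map_zero]
  -- As the radical is at most a line, `t` is a pure tensor `κ ⊗ v₀`, with value `κ² φ v₀`.
  obtain ⟨v₀, hv₀⟩ := finrank_le_one_iff.1 hφ.1
  choose r hr using fun a => hv₀ ⟨c a, hc a⟩
  have hr' : ∀ a, c a = r a • (v₀ : V) := fun a => (congrArg Subtype.val (hr a)).symm
  have hsum : (c.sum fun i n => ℬ i ⊗ₜ[F] n) = (∑ i ∈ c.support, r i • ℬ i) ⊗ₜ[F] (v₀ : V) := by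
    rw [TensorProduct.sum_tmul, Finsupp.sum]
    refine Finset.sum_congr rfl fun i _ => ?_
    rw [TensorProduct.smul_tmul, ← hr']
  rw [hsum, formBaseChange_tmul, mul_eq_zero, mul_self_eq_zero, map_eq_zero] at h0
  rw [hsum]
  rcases h0 with h0 | h0
  · rw [h0, TensorProduct.zero_tmul]
  · rw [hφ.2 _ v₀.2 h0, TensorProduct.tmul_zero]

/-- A form of dimension at least four that has a nontrivial zero has a totally isotropic plane
over an extension of degree at most two. -/
theorem exists_hasIsotropicPair_of_isotropic (hV : 4 ≤ Module.finrank F V) {x : V} (hx : x ≠ 0)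
    (h0 : φ x = 0) : ∃ (K : Type u) (_ : Field K) (_ : Algebra F K),
      0 < Module.finrank F K ∧ Module.finrank F K ≤ 2 ∧ HasIsotropicPair (formMatrix φ) K := by
  let b := Module.finBasis F V
  have hcoord : ∀ z : V, z ≠ 0 → ∃ i, b.coord i z ≠ 0 := by
    intro z hz
    by_contra! h
    exact hz (b.forall_coord_eq_zero_iff.1 h)
  obtain ⟨i, hi⟩ := hcoord x hx
  -- The coordinate conditions put `x, y, z` in echelon form, which gives independence over every
  -- extension. For `z` there are three linear conditions, hence dimension at least four.
  obtain ⟨y, hy, hy0⟩ := Submodule.exists_mem_ne_zero_of_ne_bot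
    (LinearMap.ker_ne_bot_of_finrank_lt (f := (φ.polarBilin x).prod (b.coord i)) (by
      simp only [Module.finrank_prod, Module.finrank_self]
      omega))
  obtain ⟨j, hj⟩ := hcoord y hy0
  obtain ⟨z, hz, hz0⟩ := Submodule.exists_mem_ne_zero_of_ne_bot
    (LinearMap.ker_ne_bot_of_finrank_lt
      (f := (φ.polarBilin x).prod ((b.coord i).prod (b.coord j))) (by
      simp only [Module.finrank_prod, Module.finrank_self]
      omega))
  obtain ⟨k, hk⟩ := hcoord z hz0
  have hxy : QuadraticMap.polar φ x y = 0 := congrArg Prod.fst (LinearMap.mem_ker.1 hy)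
  have hyi : b.coord i y = 0 := congrArg Prod.snd (LinearMap.mem_ker.1 hy)
  have hxz : QuadraticMap.polar φ x z = 0 := congrArg Prod.fst (LinearMap.mem_ker.1 hz)
  have hzi : b.coord i z = 0 := congrArg (fun w => w.2.1) (LinearMap.mem_ker.1 hz)
  have hzj : b.coord j z = 0 := congrArg (fun w => w.2.2) (LinearMap.mem_ker.1 hz)
  let p : Polynomial F := Polynomial.C (φ y) * Polynomial.X ^ 2 +
    Polynomial.C (QuadraticMap.polar φ y z) * Polynomial.X + Polynomial.C (φ z)
  have hne : ∀ (K : Type u) [Field K] [Algebra F K], (1 : K) ⊗ₜ[F] x ≠ 0 := by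
    intro K _ _ h
    have := congrArg (fun t => (b.baseChange K).repr t i) h
    simp only [Module.Basis.baseChange_repr_tmul, map_zero, Finsupp.zero_apply] at this
    rw [Algebra.smul_def, mul_one, map_eq_zero] at this
    exact hi this
  by_cases hφy : φ y = 0
  · refine ⟨F, inferInstance, inferInstance, by simp, by simp, ?_⟩
    refine hasIsotropicPair_of_formBaseChange (s := (1 : F) ⊗ₜ x) (t := (1 : F) ⊗ₜ y) (hne F)
      (fun c hc => ?_) ?_ ?_ ?_
    · have hi' := congrArg (fun t => (b.baseChange F).repr t i) hc
      have hj' := congrArg (fun t => (b.baseChange F).repr t j) hc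
      simp only [map_smul, Finsupp.smul_apply, Module.Basis.baseChange_repr_tmul,
        smul_eq_mul, mul_one] at hi' hj'
      change b.coord i y = c * b.coord i x at hi'
      change b.coord j y = c * b.coord j x at hj'
      rw [hyi, zero_eq_mul] at hi'
      rw [hi'.resolve_right hi, zero_mul] at hj'
      exact hj hj'
    · simp [formBaseChange_tmul, h0]
    · simp [formBaseChange_tmul, hφy]
    · simp [polar_formBaseChange_tmul, hxy]
  · have hdeg : p.natDegree = 2 := Polynomial.natDegree_quadratic hφy
    have hp0 : p ≠ 0 := by
      intro h
      simp [h] at hdeg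
    have hnu : ¬ IsUnit p := Polynomial.not_isUnit_of_natDegree_pos p (by omega)
    -- `p` evaluates `φ` at `X y + z`; adjoining a root of an irreducible factor covers the split
    -- and nonsplit cases at once.
    have hirr : Irreducible p.factor := Polynomial.irreducible_factor p
    have : Fact (Irreducible p.factor) := ⟨hirr⟩
    have hdvd : p.factor ∣ p := Polynomial.factor_dvd_of_not_isUnit hnu
    let K := AdjoinRoot p.factor
    let α : K := AdjoinRoot.root p.factor
    have hα : algebraMap F K (φ y) * α ^ 2 + algebraMap F K (QuadraticMap.polar φ y z) * α +
        algebraMap F K (φ z) = 0 := by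
      have h1 : AdjoinRoot.mk p.factor (Polynomial.C (φ y) * Polynomial.X ^ 2 +
          Polynomial.C (QuadraticMap.polar φ y z) * Polynomial.X + Polynomial.C (φ z)) = 0 :=
        AdjoinRoot.mk_eq_zero.2 hdvd
      simp only [map_add, map_mul, map_pow, AdjoinRoot.mk_X, AdjoinRoot.mk_C] at h1
      exact h1
    have hfin : Module.finrank F K = p.factor.natDegree := by
      rw [(AdjoinRoot.powerBasis hirr.ne_zero).finrank, AdjoinRoot.powerBasis_dim]
    refine ⟨K, inferInstance, inferInstance, ?_, ?_, ?_⟩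
    · rw [hfin]
      exact hirr.natDegree_pos
    · rw [hfin, ← hdeg]
      exact Polynomial.natDegree_le_of_dvd hdvd hp0
    · refine hasIsotropicPair_of_formBaseChange (s := (1 : K) ⊗ₜ x) (t := α ⊗ₜ y + 1 ⊗ₜ z)
        (hne K) (fun c hc => ?_) ?_ ?_ ?_
      · have hrepr : ∀ l, α * algebraMap F K (b.coord l y) + algebraMap F K (b.coord l z) =
            c * algebraMap F K (b.coord l x) := by
          intro l
          have hl := congrArg (fun t => (b.baseChange K).repr t l) hc
          simp only [map_smul, map_add, Finsupp.add_apply, Finsupp.smul_apply,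
            Module.Basis.baseChange_repr_tmul, Algebra.smul_def, mul_one] at hl
          rw [mul_comm α]
          exact hl
        have hc0 : c = 0 := by
          have := hrepr i
          rw [hyi, hzi, map_zero, mul_zero, add_zero, zero_eq_mul, map_eq_zero] at this
          exact this.resolve_right hi
        have hα0 : α = 0 := by
          have := hrepr j
          rw [hzj, hc0, map_zero, zero_mul, add_zero, mul_eq_zero, map_eq_zero] at this
          exact this.resolve_right hj
        have := hrepr k
        rw [hα0, hc0, zero_mul, zero_mul, zero_add, map_eq_zero] at this
        exact hk this
      · simp [formBaseChange_tmul, h0]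
      · rw [QuadraticMap.map_add (formBaseChange φ K), formBaseChange_tmul, formBaseChange_tmul,
          polar_formBaseChange_tmul]
        linear_combination hα
      · rw [QuadraticMap.polar_add_right, polar_formBaseChange_tmul, polar_formBaseChange_tmul,
          hxy, hxz, map_zero, mul_zero, mul_zero, add_zero]

end BaseChange

/-! ### Witt decompositions -/

section Witt

variable {E : Type u} [Field E] {V : Type v} [AddCommGroup V] [Module E V] {φ : QuadraticForm E V}

/-- An isotropic vector that is not in the radical is part of a hyperbolic pair. -/
theorem exists_hyperbolic_pair {x y : V} (hx : φ x = 0) (hxy : QuadraticMap.polar φ x y ≠ 0) :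
    ∃ z, φ z = 0 ∧ QuadraticMap.polar φ x z = 1 := by
  have hxx : QuadraticMap.polar φ x x = 0 := by
    rw [QuadraticMap.polar_self, hx, smul_zero]
  let c := (QuadraticMap.polar φ x y)⁻¹
  have hc : c * QuadraticMap.polar φ x y = 1 := inv_mul_cancel₀ hxy
  -- Scale `y` to pair to one with `x`; adding `λ x` then changes the value of `φ` by `λ`, in any
  -- characteristic.
  refine ⟨c • y + (-(c * c * φ y)) • x, ?_, ?_⟩
  · rw [QuadraticMap.map_add φ, QuadraticMap.map_smul, QuadraticMap.map_smul,
      QuadraticMap.polar_smul_left, QuadraticMap.polar_smul_right, hx,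
      QuadraticMap.polar_comm φ y x]
    simp only [smul_eq_mul]
    linear_combination (-(c * c * φ y)) * hc
  · rw [QuadraticMap.polar_add_right, QuadraticMap.polar_smul_right,
      QuadraticMap.polar_smul_right, hxx]
    simpa using hc

/-- Splitting off the hyperbolic plane of a hyperbolic pair with anisotropic orthogonal
complement. -/
theorem isWittDecomposition_one {x y : V} (hx : φ x = 0) (hy : φ y = 0)
    (hxy : QuadraticMap.polar φ x y = 1)
    (h : (φ.restrict
      (LinearMap.ker (φ.polarBilin x) ⊓ LinearMap.ker (φ.polarBilin y))).Anisotropic) :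
    IsWittDecomposition φ 1 (LinearMap.ker (φ.polarBilin x) ⊓ LinearMap.ker (φ.polarBilin y)) := by
  refine ⟨h, ?_⟩
  set W := LinearMap.ker (φ.polarBilin x) ⊓ LinearMap.ker (φ.polarBilin y)
  have hxx : QuadraticMap.polar φ x x = 0 := by
    rw [QuadraticMap.polar_self, hx, smul_zero]
  have hyy : QuadraticMap.polar φ y y = 0 := by
    rw [QuadraticMap.polar_self, hy, smul_zero]
  have hyx : QuadraticMap.polar φ y x = 1 := by
    rw [QuadraticMap.polar_comm, hxy]
  have hWx : ∀ w ∈ W, QuadraticMap.polar φ x w = 0 := fun w hw => LinearMap.mem_ker.1 hw.1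
  have hWy : ∀ w ∈ W, QuadraticMap.polar φ y w = 0 := fun w hw => LinearMap.mem_ker.1 hw.2
  -- Pairing `f ((g, a), w)` with `x` and with `y` recovers `a 0` and `g (fun _ => 1)`, which gives
  -- injectivity and the projection formula for surjectivity.
  let f : (Module.Dual E (Fin 1 → E) × (Fin 1 → E)) × W →ₗ[E] V :=
    LinearMap.coprod (LinearMap.coprod
      ((LinearMap.toSpanSingleton E V x).comp (LinearMap.applyₗ (fun _ => 1)))
      ((LinearMap.toSpanSingleton E V y).comp (LinearMap.proj 0))) W.subtype
  have hf : ∀ g a w, f ((g, a), w) = g (fun _ => 1) • x + a 0 • y + (w : V) := fun g a w => rfl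
  have hfx : ∀ g a w, QuadraticMap.polar φ x (f ((g, a), w)) = a 0 := by
    intro g a w
    rw [hf, QuadraticMap.polar_add_right, QuadraticMap.polar_add_right,
      QuadraticMap.polar_smul_right, QuadraticMap.polar_smul_right, hxx, hxy, hWx w w.2]
    simp
  have hfy : ∀ g a w, QuadraticMap.polar φ y (f ((g, a), w)) = g (fun _ => 1) := by
    intro g a w
    rw [hf, QuadraticMap.polar_add_right, QuadraticMap.polar_add_right,
      QuadraticMap.polar_smul_right, QuadraticMap.polar_smul_right, hyy, hyx, hWy w w.2]
    simp
  have hdual : ∀ (g : Module.Dual E (Fin 1 → E)) (a : Fin 1 → E), g a = a 0 * g (fun _ => 1) := by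
    intro g a
    have : a = a 0 • (fun _ => 1 : Fin 1 → E) := by
      funext i
      simp [Subsingleton.elim i 0]
    conv_lhs => rw [this, map_smul, smul_eq_mul]
  have hinj : Function.Injective f := by
    rw [injective_iff_map_eq_zero]
    rintro ⟨⟨g, a⟩, w⟩ h0
    have ha : a 0 = 0 := by
      rw [← hfx g a w, h0, QuadraticMap.polar_zero_right]
    have hg : g (fun _ => 1) = 0 := by
      rw [← hfy g a w, h0, QuadraticMap.polar_zero_right]
    rw [hf, ha, hg, zero_smul, zero_smul, zero_add, zero_add] at h0
    have hg0 : g = 0 := LinearMap.ext fun b => by rw [hdual, hg, mul_zero, LinearMap.zero_apply]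
    have ha0 : a = 0 := funext fun i => by rw [Subsingleton.elim i 0, ha, Pi.zero_apply]
    have hw0 : w = 0 := Subtype.ext h0
    rw [hg0, ha0, hw0]
    rfl
  have hsurj : Function.Surjective f := by
    intro v
    let w := v - QuadraticMap.polar φ y v • x - QuadraticMap.polar φ x v • y
    have hw : w ∈ W := by
      constructor
      · refine LinearMap.mem_ker.2 ?_
        simp only [w, map_sub, map_smul, QuadraticMap.polarBilin_apply_apply, hxx, hxy, smul_eq_mul]
        ring
      · refine LinearMap.mem_ker.2 ?_
        simp only [w, map_sub, map_smul, QuadraticMap.polarBilin_apply_apply, hyy, hyx, smul_eq_mul]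
        ring
    refine ⟨((QuadraticMap.polar φ y v • LinearMap.proj 0,
      fun _ => QuadraticMap.polar φ x v), ⟨w, hw⟩), ?_⟩
    rw [hf]
    simp only [LinearMap.smul_apply, LinearMap.proj_apply, smul_eq_mul, mul_one, w]
    abel
  refine QuadraticMap.Equivalent.symm
    ⟨{ LinearEquiv.ofBijective f ⟨hinj, hsurj⟩ with map_app' := ?_ }⟩
  rintro ⟨⟨g, a⟩, w⟩
  change φ (f ((g, a), w)) = g a + φ w
  rw [hf, QuadraticMap.map_add φ, QuadraticMap.map_add φ, QuadraticMap.map_smul,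
    QuadraticMap.map_smul, hx, hy, QuadraticMap.polar_add_left, QuadraticMap.polar_smul_left,
    QuadraticMap.polar_smul_left, QuadraticMap.polar_smul_left, QuadraticMap.polar_smul_right,
    hxy, hWx w w.2, hWy w w.2, hdual g a]
  simp only [smul_eq_mul]
  ring

theorem IsWittDecomposition.anisotropic_of_zero {W : Submodule E V}
    (h : IsWittDecomposition φ 0 W) : φ.Anisotropic := by
  obtain ⟨ha, ⟨e⟩⟩ := h
  intro v hv
  have h1 : QuadraticForm.dualProd E (Fin 0 → E) (e v).1 + φ.restrict W (e v).2 = 0 := by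
    rw [← QuadraticMap.prod_apply, e.map_app, hv]
  have h2 : (e v).1 = 0 := Subsingleton.elim _ _
  rw [h2, QuadraticMap.map_zero, zero_add] at h1
  have h3 : e v = 0 := Prod.ext h2 (ha _ h1)
  exact e.toLinearEquiv.map_eq_zero_iff.1 h3

theorem IsWittDecomposition.eq_zero_of_anisotropic {W : Submodule E V} {m : ℕ}
    (h : IsWittDecomposition φ m W) (hφ : φ.Anisotropic) : m = 0 := by
  obtain ⟨-, ⟨e⟩⟩ := h
  by_contra hm
  let a : Fin m → E := fun _ => 1
  have h1 : φ (e.symm ((0, a), 0)) = 0 := by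
    rw [e.symm.map_app]
    simp [QuadraticMap.prod_apply]
  have h2 := e.symm.toLinearEquiv.map_eq_zero_iff.1 (hφ _ h1)
  have h3 := congrFun (congrArg (fun z => z.1.2) h2) ⟨0, Nat.pos_of_ne_zero hm⟩
  exact one_ne_zero h3

/-- The anisotropic part of an anisotropic form has the dimension of the whole space. -/
theorem anisotropicSubspace_of_anisotropic (hφ : φ.Anisotropic) :
    (φ.restrict (anisotropicSubspace φ)).Anisotropic ∧
      Module.finrank E (anisotropicSubspace φ) = Module.finrank E V := by
  let : Unique (Module.Dual E (Fin 0 → E) × (Fin 0 → E)) := Unique.mk' _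
  -- `anisotropicSubspace` is an `epsilon` choice, so it has its property only once some
  -- decomposition exists; `V` itself with `m = 0` serves.
  have hex : ∃ W : Submodule E V, ∃ m, IsWittDecomposition φ m W := by
    refine ⟨⊤, 0, fun v hv => Subtype.ext (hφ _ hv), ?_⟩
    refine ⟨{ (Submodule.topEquiv.symm : V ≃ₗ[E] (⊤ : Submodule E V)).trans
      (LinearEquiv.uniqueProd (R := E) (M₂ := Module.Dual E (Fin 0 → E) × (Fin 0 → E))).symm with
      map_app' := fun v => ?_ }⟩
    change QuadraticForm.dualProd E (Fin 0 → E) default + φ v = φ v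
    rw [Subsingleton.elim default 0, QuadraticMap.map_zero, zero_add]
  obtain ⟨m, hm⟩ := Classical.epsilon_spec hex
  change IsWittDecomposition φ m (anisotropicSubspace φ) at hm
  obtain rfl := hm.eq_zero_of_anisotropic hφ
  refine ⟨hm.1, ?_⟩
  obtain ⟨-, ⟨e⟩⟩ := hm
  rw [e.toLinearEquiv.finrank_eq]
  exact (LinearEquiv.uniqueProd (R := E)
    (M₂ := Module.Dual E (Fin 0 → E) × (Fin 0 → E))).symm.finrank_eq

/-- The Witt index of an isotropic form that is anisotropic on its radical and has no totally
isotropic planes. -/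
theorem wittIndex_eq_one {x : V} (hx0 : x ≠ 0) (hx : φ x = 0)
    (hrad : ∀ v, φ v = 0 → (∀ w, QuadraticMap.polar φ v w = 0) → v = 0)
    (hplane : ∀ s t, s ≠ 0 → φ s = 0 → φ t = 0 → QuadraticMap.polar φ s t = 0 →
      ∃ c : E, t = c • s) : wittIndex φ = 1 := by
  obtain ⟨y, hy⟩ : ∃ y, QuadraticMap.polar φ x y ≠ 0 := by
    by_contra! h
    exact hx0 (hrad x hx h)
  obtain ⟨z, hz, hxz⟩ := exists_hyperbolic_pair hx hy
  have hmem : 1 ∈ {m | ∃ W : Submodule E V, IsWittDecomposition φ m W} := by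
    refine ⟨_, isWittDecomposition_one hx hz hxz ?_⟩
    rintro ⟨w, hw1, hw2⟩ hw
    -- An isotropic vector orthogonal to `x` is a multiple of `x`; orthogonality to `z` kills the
    -- multiple.
    obtain ⟨c, rfl⟩ := hplane x w hx0 hx hw (LinearMap.mem_ker.1 hw1)
    have : c = 0 := by
      have h := LinearMap.mem_ker.1 hw2
      rw [QuadraticMap.polarBilin_apply_apply, QuadraticMap.polar_smul_right,
        QuadraticMap.polar_comm, hxz] at h
      simpa using h
    refine Subtype.ext ?_
    change c • x = 0
    rw [this, zero_smul]
  refine le_antisymm (Nat.sInf_le hmem) (Nat.one_le_iff_ne_zero.2 fun h0 => ?_)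
  obtain ⟨W, hW⟩ := Nat.sInf_mem ⟨1, hmem⟩
  rw [wittIndex] at h0
  rw [h0] at hW
  exact hx0 (hW.anisotropic_of_zero x hx)

end Witt

/-! ### The function field of the quadric -/

/-- Totally isotropic pairs over the function field of an anisotropic quadric specialize to a
quadratic extension of the base field. -/
theorem HasIsotropicPair.exists_quadratic_of_functionField {F : Type u} [Field F] {U : Type v}
    [AddCommGroup U] [Module F U] [FiniteDimensional F U] (ψ : QuadraticForm F U)
    (h : ψ.Anisotropic) (h2 : 2 ≤ Module.finrank F U) {ι : Type*} [Fintype ι] [DecidableEq ι]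
    {B : ι → ι → F} (hB : HasIsotropicPair B (quadricFunctionField ψ h h2).carrier) :
    ∃ (K : Type u) (_ : Field K) (_ : Algebra F K),
      Module.finrank F K = 2 ∧ HasIsotropicPair B K := by
  have hC : ∀ x, x ≠ 0 → MvPolynomial.eval x (quadricPolynomial (formMatrix ψ)) ≠ 0 := by
    intro x hx h0
    have h1 := h _ ((eval_formPolynomial ψ x).symm.trans h0)
    exact hx (funext (Fintype.linearIndependent_iff.1 (Module.finBasis F U).linearIndependent x h1))
  have := isDomain_quotient_quadricPolynomial (formMatrix ψ) h2 hC
  have : (Ideal.span {formPolynomial ψ}).IsPrime :=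
    (Ideal.span_singleton_prime (prime_formPolynomial ψ h h2).ne_zero).2
      (prime_formPolynomial ψ h h2)
  refine HasIsotropicPair.exists_quadratic h2 (formMatrix ψ) hC ?_
  -- The function field sits inside the fraction field of the affine cone, so the specialization can
  -- be done on the cone.
  have hfrac : HasIsotropicPair B (FractionRing (MvPolynomial (Fin (Module.finrank F U)) F ⧸
      Ideal.span {quadricPolynomial (formMatrix ψ)})) :=
    hB.map (IntermediateField.val _) Subtype.val_injective
  exact hfrac.of_fractionRing

/-- An anisotropic form becomes isotropic over the function field of its quadric. -/
theorem exists_isotropic_functionField {F : Type u} [Field F] {U : Type v} [AddCommGroup U]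
    [Module F U] [FiniteDimensional F U] (ψ : QuadraticForm F U) (h : ψ.Anisotropic)
    (h2 : 2 ≤ Module.finrank F U) :
    ∃ t : (quadricFunctionField ψ h h2).carrier ⊗[F] U, t ≠ 0 ∧
      formBaseChange ψ (quadricFunctionField ψ h h2).carrier t = 0 := by
  have hp := prime_formPolynomial ψ h h2
  have : (Ideal.span {formPolynomial ψ}).IsPrime := (Ideal.span_singleton_prime hp.ne_zero).2 hp
  let A := MvPolynomial (Fin (Module.finrank F U)) F ⧸ Ideal.span {formPolynomial ψ}
  let x : Fin (Module.finrank F U) → FractionRing A := fun i =>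
    algebraMap A (FractionRing A) (Ideal.Quotient.mk _ (MvPolynomial.X i))
  let L := IntermediateField.adjoin F {z : FractionRing A | ∃ i j, z = x i / x j}
  change ∃ t : L ⊗[F] U, t ≠ 0 ∧ formBaseChange ψ L t = 0
  obtain ⟨i, hi⟩ : ∃ i, x i ≠ 0 := by
    by_contra! hx
    have hX : formPolynomial ψ ∣ MvPolynomial.X ⟨0, by omega⟩ :=
      Ideal.mem_span_singleton.1 (Ideal.Quotient.eq_zero_iff_mem.1
        ((map_eq_zero_iff _ (IsFractionRing.injective A (FractionRing A))).1 (hx _)))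
    have hdeg := MvPolynomial.totalDegree_le_of_dvd_of_isDomain hX (MvPolynomial.X_ne_zero _)
    rw [(isHomogeneous_formPolynomial ψ).totalDegree hp.ne_zero, MvPolynomial.totalDegree_X] at hdeg
    omega
  -- Coordinates of the generic point of the quadric, normalized by a nonzero `x i` so that they lie
  -- in `L`.
  let y : Fin (Module.finrank F U) → L := fun j =>
    ⟨x j / x i, IntermediateField.subset_adjoin F _ ⟨j, i, rfl⟩⟩
  let b := (Module.finBasis F U).baseChange L
  have hrepr : ⇑(b.repr (∑ j, y j • b j)) = y := b.repr_sum_self y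
  refine ⟨∑ j, y j • b j, fun h0 => ?_, ?_⟩
  · have h1 := Fintype.linearIndependent_iff.1 b.linearIndependent y h0 i
    have h3 : x i / x i = 0 := congrArg Subtype.val h1
    rw [div_self hi] at h3
    exact one_ne_zero h3
  · rw [formBaseChange_eq_coordForm, hrepr]
    have hinj : Function.Injective L.val := L.val.injective
    refine hinj ?_
    rw [← coordForm_map, map_zero]
    have hy : (fun j => L.val (y j)) = (x i)⁻¹ • x := by
      funext j
      change x j / x i = (x i)⁻¹ * x j
      rw [div_eq_inv_mul]
    have hx0 : coordForm (formMatrix ψ) (FractionRing A) x x = 0 := by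
      rw [← aeval_formPolynomial]
      have : MvPolynomial.aeval x = (IsScalarTower.toAlgHom F A (FractionRing A)).comp
          (Ideal.Quotient.mkₐ F (Ideal.span {formPolynomial ψ})) :=
        MvPolynomial.algHom_ext fun i => MvPolynomial.aeval_X x i
      rw [this, AlgHom.comp_apply, Ideal.Quotient.mkₐ_eq_mk,
        Ideal.Quotient.eq_zero_iff_mem.2 (Ideal.mem_span_singleton_self _), map_zero]
    refine (congrArg₂ (fun s t => coordForm (formMatrix ψ) (FractionRing A) s t) hy hy).trans ?_
    simp [hx0]

/-- The Witt index over the function field of the quadric of an anisotropic subform, for a form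
without totally isotropic planes over extensions of degree two. -/
theorem wittIndex_functionField {F : Type u} [Field F] {V : Type v} [AddCommGroup V] [Module F V]
    [FiniteDimensional F V] {φ : QuadraticForm F V} (hφ : IsNondegenerateForm φ)
    (hK : ∀ (K : Type u) [Field K] [Algebra F K], Module.finrank F K = 2 →
      ¬ HasIsotropicPair (formMatrix φ) K)
    {U : Type*} [AddCommGroup U] [Module F U] [FiniteDimensional F U] {ψ : QuadraticForm F U}
    (h : ψ.Anisotropic) (h2 : 2 ≤ Module.finrank F U) (l : U →ₗ[F] V)
    (hl : ∀ x, φ (l x) = ψ x) :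
    wittIndex (formBaseChange φ (quadricFunctionField ψ h h2).carrier) = 1 := by
  obtain ⟨t, ht0, ht⟩ := exists_isotropic_functionField ψ h h2
  set L := (quadricFunctionField ψ h h2).carrier
  have hlinj : Function.Injective l := (injective_iff_map_eq_zero l).2 fun x hx =>
    h x (by rw [← hl, hx, QuadraticMap.map_zero])
  have hlL : Function.Injective (l.baseChange L) :=
    Module.Flat.lTensor_preserves_injective_linearMap l hlinj
  refine wittIndex_eq_one (x := l.baseChange L t) ((map_ne_zero_iff _ hlL).2 ht0)
    ((formBaseChange_baseChange_apply l hl t).trans ht)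
    (fun v h0 hp => hφ.eq_zero_of_polar_eq_zero h0 hp) ?_
  intro s t hs h1 h3 h4
  by_contra! hc
  obtain ⟨K, _, _, hfin, hpair⟩ :=
    (hasIsotropicPair_of_formBaseChange hs hc h1 h3 h4).exists_quadratic_of_functionField ψ h h2
  exact hK K hfin hpair

/-! ### Anisotropy and the first absolute Witt index -/

theorem mainTheorem5 {F : Type u} [Field F] {V : Type v} [AddCommGroup V] [Module F V]
    [FiniteDimensional F V] (n : ℕ) (hn : 3 ≤ n) (hV : Module.finrank F V = 2 * n + 1)
    (φ : QuadraticForm F V) (hφ : IsNondegenerateForm φ)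
    (hdeg : degreeImage (isotropicPlaneVarietyToSpec φ) = {d : ℤ | 4 ∣ d}) :
    absoluteWittIndex φ 1 = 1 ∧ φ.Anisotropic := by
  have hK := not_hasIsotropicPair_of_degreeImage φ hdeg
  have hani : φ.Anisotropic := by
    intro x h0
    by_contra hx
    obtain ⟨K, _, _, h1, h2, h3⟩ := exists_hasIsotropicPair_of_isotropic (by omega) hx h0
    exact hK K h1 h2 h3
  refine ⟨?_, hani⟩
  -- The tower starts with `F` as an extension of itself, so its first step uses the form on `F ⊗
  -- V`.
  have hlid : ∀ x : F ⊗[F] V, φ (TensorProduct.lid F V x) = formBaseChange φ F x := by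
    intro x
    obtain ⟨v, rfl⟩ := (TensorProduct.lid F V).symm.surjective x
    rw [LinearEquiv.apply_symm_apply, TensorProduct.lid_symm_apply, formBaseChange_tmul]
    simp
  have hani' : (formBaseChange φ F).Anisotropic := by
    intro x hx
    rw [← hlid] at hx
    exact (TensorProduct.lid F V).map_eq_zero_iff.1 (hani _ hx)
  obtain ⟨ha, hd⟩ := anisotropicSubspace_of_anisotropic hani'
  have hd2 : 2 ≤ Module.finrank F (anisotropicSubspace (formBaseChange φ F)) := by
    rw [hd, (TensorProduct.lid F V).finrank_eq]
    omega
  have hstep : splittingTower φ 1 = quadricFunctionField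
      (V := anisotropicSubspace (formBaseChange φ F))
      ((formBaseChange φ F).restrict (anisotropicSubspace (formBaseChange φ F))) ha hd2 := by
    let L := quadricFunctionField
      (V := anisotropicSubspace (formBaseChange φ F))
      ((formBaseChange φ F).restrict (anisotropicSubspace (formBaseChange φ F))) ha hd2
    -- The tower step equips `L` with the composite `F → F → L`, to be identified with the original
    -- structure.
    have halg : ((algebraMap F L.carrier).comp (algebraMap F F)).toAlgebra = L.algebra :=
      Algebra.algebra_ext _ _ fun _ => rfl
    refine Eq.trans (b := FieldExtension.mk L.carrier
      (algebra := ((algebraMap F L.carrier).comp (algebraMap F F)).toAlgebra)) ?_ ?_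
    · exact dif_pos (⟨ha, hd2⟩ : _ ∧ _)
    · rw [halg]
  refine (congrArg (fun L : FieldExtension F =>
    wittIndex (formBaseChange φ L.carrier)) hstep).trans ?_
  exact wittIndex_functionField (U := anisotropicSubspace (formBaseChange φ F)) hφ
    (fun K _ _ h => hK K (by omega) h.le) ha hd2
    ((TensorProduct.lid F V).toLinearMap.comp (Submodule.subtype _)) fun x => hlid x
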